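/- Let $k>1$ be an integer and $p$ an odd prime. Write $q=e^{2\pi i\tau}$, let $\chi_1$ be the trivial character (with value $1$ everywhere), let $\chi_{-4}(n)=\left(\frac{-4}{n}\right)$ be the Kronecker symbol, and put $p_\chi=\chi_{-4}(p)\,p$. Define $B_n$ and $B_{n,\chi_{-4}}$ by $$\sum_{n\ge0}\frac{B_n}{n!}x^n=\frac{x}{e^x-1},\qquad \sum_{n\ge0}\frac{B_{n,\chi_{-4}}}{n!}x^n=\sum_{a=1}^{4}\frac{\chi_{-4}(a)\,x\,e^{ax}}{e^{4x}-1},$$ put $\sigma_{(m,\chi,\psi)}(n)=\sum_{1\le d\mid n}\chi(d)\psi(n/d)d^m$ and $\sigma_m=\sigma_{(m,\chi_1,\chi_1)}$, and let $$E_{2k}(\tau)=1-\frac{4k}{B_{2k}}\sum_{n\ge1}\sigma_{2k-1}(n)q^n,\qquad E^{(1)}_{2k-1}(\tau)=-\frac{4k-2}{B_{2k-1,\chi_{-4}}}\sum_{n\ge1}\sigma_{(2k-2,\chi_1,\chi_{-4})}(n)q^n,$$ $$E^{(2)}_{2k-1}(\tau)=1-\frac{4k-2}{B_{2k-1,\chi_{-4}}}\sum_{n\ge1}\sigma_{(2k-2,\chi_{-4},\chi_1)}(n)q^n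 .$$ For a modular form $f$ of weight $w$ on $\Gamma_0(4p)$ (with trivial character or with character $\chi_{-4}$) and $c\mid 4p$, let $[0]_cf$ be the constant term of the Fourier expansion, in powers of $e^{2\pi i\tau/h}$ with $h$ the width of the cusp $1/c$ of $\Gamma_0(4p)$, of the function $(c\tau+1)^{-w}f\!\left(\frac{\tau}{c\tau+1}\right)$. For $c=4p$ this is the constant term of $f$ at $\infty$; for weight $2k-1$ and character $\chi_{-4}$ only the regular cusps $c\in\{1,4,p,4p\}$ are used. For $t\mid4$ put $$A_w(p,t,f)=\frac{[0]_tf-\chi_{-4}(p)^{tw}[0]_{tp}f}{(2^w-1)(p_\chi^w-1)},\qquad B_w(p,t,f)=\frac{p_\chi^w[0]_tf-\chi_{-4}(p)^{tw}[0]_{tp}f}{(2^w-1)(p_\chi^w-1)}.$$ (i) For every $f\in M_{2k}(\Gamma_0(4p))$ there is a cusp form $C\in S_{2k}(\Gamma_0(4p))$ such that $$f(\tau)=\sum_{d\mid4p}b_d(p,f)\,E_{2k}(d\tau)+C(\tau),$$ where $$\begin{aligned} b_1(p,f)&=2^{2k}B_{2k}(p,1,f)-B_{2k}(p,2,f),\\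 b_2(p,f)&=-2^{2k}B_{2k}(p,1,f)+(2^{2k}+1)B_{2k}(p,2,f)-B_{2k}(p,4,f),\\ b_4(p,f)&=-2^{2k}\bigl(B_{2k}(p,2,f)-B_{2k}(p,4,f)\bigr),\\ b_p(p,f)&=-p^{2k}\bigl(2^{2k}A_{2k}(p,1,f)-A_{2k}(p,2,f)\bigr),\\ b_{2p}(p,f)&=p^{2k}\bigl(2^{2k}A_{2k}(p,1,f)-(2^{2k}+1)A_{2k}(p,2,f)+A_{2k}(p,4,f)\bigr),\\ b_{4p}(p,f)&=(2p)^{2k}\bigl(A_{2k}(p,2,f)-A_{2k}(p,4,f)\bigr). \end{aligned}$$ (ii) For every $f\in M_{2k-1}(\Gamma_0(4p),\chi_{-4})$ there is a cusp form $C\in S_{2k-1}(\Gamma_0(4p),\chi_{-4})$ such that $$f(\tau)=a_1(p,f)E^{(2)}_{2k-1}(\tau)+a_2(p,f)E^{(2)}_{2k-1}(p\tau)+a_3(p,f)E^{(1)}_{2k-1}(\tau)+a_4(p,f)E^{(1)}_{2k-1}(p\tau)+C(\tau),$$ where $$\begin{aligned} a_1(p,f)&=(2^{2k-1}-1)\,B_{2k-1}(p,4,f),\\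 a_2(p,f)&=-(2^{2k-1}-1)\,p_\chi^{2k-1}A_{2k-1}(p,4,f),\\ a_3(p,f)&=\frac{i\,4^{2k-1}(2^{2k-1}-1)}{2}\,B_{2k-1}(p,1,f),\\ a_4(p,f)&=\frac{-i\,(4p)^{2k-1}(2^{2k-1}-1)}{2}\,A_{2k-1}(p,1,f). \end{aligned}$$ -/

import Mathlib

open UpperHalfPlane CongruenceSubgroup Matrix.SpecialLinearGroup
open scoped MatrixGroups ModularForm

noncomputable section

namespace EisensteinPart

/-! ### Characters -/

/-- The character `χ₋₄`, the Kronecker symbol `(-4 / ·)`, as a Dirichlet character modulo `4`. -/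
def chiNegFour : DirichletCharacter ℂ 4 :=
  ZMod.χ₄.ringHomComp (Int.castRingHom ℂ)

/-- The character of modulus `4 * p` induced by `χ₋₄`. -/
def chiNegFourLevel (p : ℕ) : DirichletCharacter ℂ (4 * p) :=
  DirichletCharacter.changeLevel (Dvd.intro p rfl) chiNegFour

/-! ### Modular forms with character -/

/-- The space `M_k(Γ₀(N), χ)`: the modular forms `f` of weight `k` for `Γ₁(N)` such that
`f ∣[k] γ = χ(d) f` for every `γ = (a, b; c, d)` in `Γ₀(N)`. -/
def modularFormsWithCharacter (N : ℕ) (k : ℤ) (χ : DirichletCharacter ℂ N) :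
    Set (ModularForm (Gamma1 N : Subgroup (GL (Fin 2) ℝ)) k) :=
  {f | ∀ γ ∈ Gamma0 N, (f : ℍ → ℂ) ∣[k] γ = χ ((γ 1 1 : ℤ) : ZMod N) • (f : ℍ → ℂ)}

/-- The space `S_k(Γ₀(N), χ)`: the cusp forms `f` of weight `k` for `Γ₁(N)` such that
`f ∣[k] γ = χ(d) f` for every `γ = (a, b; c, d)` in `Γ₀(N)`. -/
def cuspFormsWithCharacter (N : ℕ) (k : ℤ) (χ : DirichletCharacter ℂ N) :
    Set (CuspForm (Gamma1 N : Subgroup (GL (Fin 2) ℝ)) k) :=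
  {f | ∀ γ ∈ Gamma0 N, (f : ℍ → ℂ) ∣[k] γ = χ ((γ 1 1 : ℤ) : ZMod N) • (f : ℍ → ℂ)}

/-! ### Eisenstein series -/

/-- The generalized Bernoulli numbers attached to a character `χ` modulo `L`, given by
`∑ₙ B_{n,χ} xⁿ / n! = ∑_{a=1}^{L} χ(a) x e^{a x} / (e^{L x} - 1)`.
The inverted power series is `(e^{L x} - 1) / x`. -/
def generalizedBernoulli {L : ℕ} (χ : DirichletCharacter ℂ L) (n : ℕ) : ℂ :=
  (n.factorial : ℂ) * PowerSeries.coeff n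
    ((∑ a ∈ Finset.Icc 1 L,
        PowerSeries.C (χ (a : ZMod L)) * PowerSeries.rescale (a : ℂ) (PowerSeries.exp ℂ)) *
      (PowerSeries.mk fun m : ℕ => (L : ℂ) ^ (m + 1) / ((m + 1).factorial : ℂ))⁻¹)

/-- The twisted divisor sum `σ_{(k,χ,ψ)}(n) = ∑_{d ∣ n} χ(d) ψ(n/d) d^k`. -/
def twistedSigma {M N : ℕ} (k : ℕ) (χ : DirichletCharacter ℂ M) (ψ : DirichletCharacter ℂ N)
    (n : ℕ) : ℂ :=
  ∑ d ∈ n.divisors, χ (d : ZMod M) * ψ ((n / d : ℕ) : ZMod N) * (d : ℂ) ^ k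

/-- The nome `q = e^{2 π i z}`. -/
def nome (z : ℂ) : ℂ := Complex.exp (2 * Real.pi * Complex.I * z)

/-- The series `1 - (2w / B_w) ∑_{n ≥ 1} σ_{w-1}(n) qⁿ`, that is `E_w`, for even weight `w`. -/
def eisensteinE (w : ℕ) (z : ℂ) : ℂ :=
  1 - (2 * w : ℂ) / ((bernoulli w : ℚ) : ℂ) *
    ∑' n : ℕ+, ((ArithmeticFunction.sigma (w - 1) n : ℕ) : ℂ) * nome z ^ (n : ℕ)

/-- The series `E⁽¹⁾_w = -(2w / B_{w,χ₋₄}) ∑_{n ≥ 1} σ_{(w-1,χ₁,χ₋₄)}(n) qⁿ`, for odd weight `w`. -/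
def eisensteinE1 (w : ℕ) (z : ℂ) : ℂ :=
  -((2 * w : ℂ) / generalizedBernoulli chiNegFour w) *
    ∑' n : ℕ+, twistedSigma (w - 1) (1 : DirichletCharacter ℂ 1) chiNegFour n * nome z ^ (n : ℕ)

/-- The series `E⁽²⁾_w = 1 - (2w / B_{w,χ₋₄}) ∑_{n ≥ 1} σ_{(w-1,χ₋₄,χ₁)}(n) qⁿ`, for odd
weight `w`. -/
def eisensteinE2 (w : ℕ) (z : ℂ) : ℂ :=
  1 - (2 * w : ℂ) / generalizedBernoulli chiNegFour w *
    ∑' n : ℕ+, twistedSigma (w - 1) chiNegFour (1 : DirichletCharacter ℂ 1) n * nome z ^ (n : ℕ)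

/-! ### Fourier coefficients at the cusps `1 / c` -/

/-- The matrix `A_c = (-1, 0; c, -1)`. -/
def cuspMatrix (c : ℕ) : SL(2, ℤ) := ⟨!![-1, 0; (c : ℤ), -1], by simp [Matrix.det_fin_two]⟩

/-- The function `τ ↦ (c τ + 1)^{-w} f(A_c⁻¹ τ)`. -/
def transformAtCusp (w : ℤ) (c : ℕ) (f : ℍ → ℂ) : ℍ → ℂ :=
  fun τ => ((c : ℂ) * (τ : ℂ) + 1) ^ (-w) * f ((cuspMatrix c)⁻¹ • τ)

/-- The width of `Γ₀(N)` at the cusp `1 / c`. -/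
def cuspWidth (N c : ℕ) : ℕ := N / Nat.gcd (c ^ 2) N

/-- The Fourier coefficient `[n]_c f` at the cusp `1 / c` of a form `f` of level `N` and weight `w`
that is regular at `1 / c`: the coefficient of `e^{2 π i n τ / h}` in the expansion of
`(c τ + 1)^{-w} f(A_c⁻¹ τ)`, where `h` is the width of the cusp. For `c = N` this is the expansion
of `f` at `∞`. -/
def fourierCoeffAtCusp (N : ℕ) (w : ℤ) (c n : ℕ) (f : ℍ → ℂ) : ℂ :=
  PowerSeries.coeff n (qExpansion (cuspWidth N c : ℝ) (transformAtCusp w c f))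

/-- The constant term `[0]_c f` at the cusp `1 / c` of a form `f` of weight `w` and
level `4 * p`. -/
def constTerm (p w c : ℕ) (f : ℍ → ℂ) : ℂ := fourierCoeffAtCusp (4 * p) w c 0 f

/-! ### The coefficients -/

/-- The number `χ₋₄(p)`. -/
def chiP (p : ℕ) : ℂ := chiNegFour (p : ZMod 4)

/-- The number `p_χ = χ₋₄(p) p`. -/
def pChi (p : ℕ) : ℂ := chiP p * p

/-- `A_w(p,t,f)`. -/
def coeffA (w p t : ℕ) (f : ℍ → ℂ) : ℂ :=
  (constTerm p w t f - chiP p ^ (t * w) * constTerm p w (t * p) f) /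
    ((2 ^ w - 1) * (pChi p ^ w - 1))

/-- `B_w(p,t,f)`. -/
def coeffB (w p t : ℕ) (f : ℍ → ℂ) : ℂ :=
  (pChi p ^ w * constTerm p w t f - chiP p ^ (t * w) * constTerm p w (t * p) f) /
    ((2 ^ w - 1) * (pChi p ^ w - 1))

end EisensteinPart

end

/-!
A form that is holomorphic, transforms under `Γ₀(4p)` by a character and tends to `0` at every cusp
is a cusp form. The cusps of `Γ₀(4p)` are represented by `1 / c` for `c ∣ 4p`
(`exists_eq_mul_cuspRep_mul_T`), so it is enough that the difference between `f` and the asserted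
combination of Eisenstein series tends to `0` at those six cusps (`isZeroAtImInfty_slash`). The
value of `f` at a regular cusp `1 / c` is by definition the constant term `[0]_c f`
(`tendsto_constTerm`). For the character `χ₋₄` the cusps `1 / 2` and `1 / (2p)` are irregular: there
the translate of `f` changes sign under a translation, hence tends to `0`
(`tendsto_zero_of_antiperiodic`).

The values of the Eisenstein series are as follows. If `F` has weight `w` and its value at the cusp
`d' / c'` is `L`, then `F(dτ)` has the value `d' ^ (-w) * L` at the cusp `1 / c`, where
`d = u d'`, `c = u c'` and `d'`, `c'` are coprime (`tendsto_scale_slash_cuspRep`). In even weight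
`E_w` has level one and the value `1` everywhere. In odd weight the `q`-series `E⁽¹⁾_w` and `E⁽²⁾_w`
have to be recognized as modular forms: they are multiples of the sums of
`φ(m, n) (m τ + n)^{-w}` over the coprime pairs `(m, n)`, with `φ(m, n) = χ₋₄(m)` and
`φ(m, n) = χ₋₄(n) [4 ∣ m]` respectively (`eisensteinE1_eq_eisSum`, `eisensteinE2_eq_eisSum`). The
sum over all pairs is the sum over the coprime ones multiplied by `L(w, χ₋₄)`, its Fourier expansion
is given by the Lipschitz formula, and the normalization by `B_{w,χ₋₄}` is correct because of the
formula for `L(w, χ₋₄)` in terms of generalized Bernoulli numbers (`factorial_mul_lValue`). The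
values of these sums at the cusps are read off from the terms with `m = 0` after the action of
`SL(2, ℤ)`, which permutes the functions `φ` (`tendsto_eisSum_slash`).

With these values the coefficients of the theorem are the solution of the linear system that
equates the values at the cusps.
-/

noncomputable section

namespace EisensteinPart

open Filter Topology Manifold EisensteinSeries Matrix

/-! ### Limits at the cusps -/

/-- The matrix `(1, 0; c, 1)`, which sends `∞` to the cusp `1 / c`. -/
def cuspRep (c : ℕ) : SL(2, ℤ) := ⟨!![1, 0; (c : ℤ), 1], by simp [Matrix.det_fin_two]⟩

@[simp] lemma coe_cuspRep (c : ℕ) :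
    (cuspRep c : Matrix (Fin 2) (Fin 2) ℤ) = !![1, 0; (c : ℤ), 1] := rfl

lemma coe_cuspRep_inv (c : ℕ) :
    ((cuspRep c)⁻¹ : SL(2, ℤ)).1 = !![1, 0; -(c : ℤ), 1] := by
  rw [Matrix.SpecialLinearGroup.coe_inv, coe_cuspRep, Matrix.adjugate_fin_two_of, neg_zero]

lemma coe_cuspMatrix_inv (c : ℕ) :
    ((cuspMatrix c)⁻¹ : SL(2, ℤ)).1 = !![-1, 0; -(c : ℤ), -1] := by
  rw [Matrix.SpecialLinearGroup.coe_inv]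
  exact (Matrix.adjugate_fin_two_of _ _ _ _).trans (by simp)

lemma slash_apply_entries (w : ℤ) (f : ℍ → ℂ) (γ : SL(2, ℤ)) (τ : ℍ) :
    (f ∣[w] γ) τ = f (γ • τ) * ((γ 1 0 : ℂ) * τ + (γ 1 1 : ℂ)) ^ (-w) := by
  rw [ModularForm.SL_slash_apply]
  simp [denom]

lemma coe_smul_entries (γ : SL(2, ℤ)) (τ : ℍ) :
    ((γ • τ : ℍ) : ℂ) =
      ((γ 0 0 : ℂ) * τ + (γ 0 1 : ℂ)) / ((γ 1 0 : ℂ) * τ + (γ 1 1 : ℂ)) := by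
  rw [UpperHalfPlane.coe_specialLinearGroup_apply]
  simp

lemma transformAtCusp_eq_slash (w : ℤ) (c : ℕ) (f : ℍ → ℂ) :
    transformAtCusp w c f = f ∣[w] cuspRep c := by
  ext τ
  have hτ : (cuspMatrix c)⁻¹ • τ = cuspRep c • τ := by
    ext
    rw [coe_smul_entries, coe_smul_entries, coe_cuspMatrix_inv, coe_cuspRep, ← neg_div_neg_eq]
    simp
    ring_nf
  rw [slash_apply_entries, transformAtCusp, hτ, mul_comm]
  simp

lemma slash_T_zpow_apply (w j : ℤ) (f : ℍ → ℂ) (τ : ℍ) :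
    (f ∣[w] (ModularGroup.T ^ j)) τ = f ((j : ℝ) +ᵥ τ) := by
  rw [slash_apply_entries, modular_T_zpow_smul, ModularGroup.coe_T_zpow]
  simp

lemma tendsto_vadd_atImInfty (x : ℝ) : Tendsto (fun τ : ℍ => x +ᵥ τ) atImInfty atImInfty := by
  rw [atImInfty]
  refine tendsto_comap_iff.2 ?_
  simpa [Function.comp_def] using (tendsto_comap : Tendsto UpperHalfPlane.im _ atTop)

lemma tendsto_coeff_zero_qExpansion {g : ℍ → ℂ} {h : ℝ} (hh : 0 < h)
    (hper : ∀ τ : ℍ, g (h +ᵥ τ) = g τ) (hol : MDiff g) (hb : IsBoundedAtImInfty g) :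
    Tendsto g atImInfty (𝓝 ((qExpansion h g).coeff 0)) := by
  have hper' : Function.Periodic (g ∘ ofComplex) h := by
    intro w
    by_cases! hw : 0 < w.im
    · have h2 : 0 < (w + h).im := by simp [hw]
      simp only [Function.comp_apply, ofComplex_apply_of_im_pos h2, ofComplex_apply_of_im_pos hw]
      rw [← hper ⟨w, hw⟩]
      congr 1
      ext
      simp [add_comm]
    · have h2 : (w + h).im ≤ 0 := by simpa using hw
      simp [ofComplex_apply_of_im_nonpos h2, ofComplex_apply_of_im_nonpos hw]
  have han := analyticAt_cuspFunction_zero hh hper' hol hb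
  have h0 : (qExpansion h g).coeff 0 = cuspFunction h g 0 := by
    simp [qExpansion_coeff]
  have hg : (cuspFunction h g ∘ fun τ : ℍ => Function.Periodic.qParam h τ) = g := by
    funext τ
    exact eq_cuspFunction τ hh.ne' hper'
  rw [h0, ← hg]
  simpa [hg] using han.continuousAt.tendsto.comp (qParam_tendsto_atImInfty hh)

instance : NeBot atImInfty := by
  rw [atImInfty]
  refine comap_neBot_iff.2 fun t ht => ?_
  obtain ⟨a, ha⟩ := mem_atTop_sets.1 ht
  exact ⟨⟨⟨0, max a 1⟩, by simp⟩, ha _ (le_max_left _ _)⟩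

/-- At an irregular cusp the local expansion has only half-integral exponents, so that the
function vanishes there. -/
lemma tendsto_zero_of_antiperiodic {g : ℍ → ℂ} {h : ℝ} (hh : 0 < h)
    (hper : ∀ τ : ℍ, g (h +ᵥ τ) = - g τ) (hol : MDiff g) (hb : IsBoundedAtImInfty g) :
    Tendsto g atImInfty (𝓝 0) := by
  have h2 : ∀ τ : ℍ, g ((h + h) +ᵥ τ) = g τ := fun τ => by
    rw [add_vadd, hper, hper, neg_neg]
  have hL := tendsto_coeff_zero_qExpansion (add_pos hh hh) h2 hol hb
  have hL' := (hL.comp (tendsto_vadd_atImInfty h)).neg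
  have : (fun τ : ℍ => -(g ∘ fun τ => h +ᵥ τ) τ) = g := by
    funext τ
    simp [hper]
  rw [this] at hL'
  have := tendsto_nhds_unique hL hL'
  rw [self_eq_neg.1 this] at hL
  exact hL

/-- Every element of `SL(2, ℤ)` is the product of an element of `Γ₀(4p)`, one of the six
representatives of the cusps, and a translation. -/
lemma exists_eq_mul_cuspRep_mul_T {p : ℕ} (hp : p.Prime) (hp2 : p ≠ 2) (γ : SL(2, ℤ)) :
    ∃ t ∈ ({1, 2, 4} : Finset ℕ), ∃ s ∈ ({1, p} : Finset ℕ), ∃ j : ℤ, ∃ γ₀ ∈ Gamma0 (4 * p),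
      γ = γ₀ * cuspRep (t * s) * ModularGroup.T ^ j := by
  have hodd : p % 2 = 1 := hp.eq_two_or_odd.resolve_left hp2
  set r := γ 1 0 with hr
  set d := γ 1 1 with hd
  have hdet : γ 0 0 * d - γ 0 1 * r = 1 := by
    have := γ.det_coe
    rwa [Matrix.det_fin_two] at this
  suffices H : ∃ t ∈ ({1, 2, 4} : Finset ℕ), ∃ s ∈ ({1, p} : Finset ℕ), ∃ j : ℤ,
      ((4 * p : ℕ) : ℤ) ∣ r + r * ((t * s : ℕ) : ℤ) * j - ((t * s : ℕ) : ℤ) * d by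
    obtain ⟨t, ht, s, hs, j, H⟩ := H
    refine ⟨t, ht, s, hs, j, γ * ModularGroup.T ^ (-j) * (cuspRep (t * s))⁻¹, ?_, ?_⟩
    · rw [Gamma0_mem, ZMod.intCast_zmod_eq_zero_iff_dvd]
      convert H using 1
      rw [Matrix.SpecialLinearGroup.coe_mul, Matrix.SpecialLinearGroup.coe_mul, coe_cuspRep_inv,
        ModularGroup.coe_T_zpow]
      simp [Matrix.mul_apply, Fin.sum_univ_two, ← hr, ← hd]
      ring
    · simp [mul_assoc]
  -- The conditions modulo `4` and modulo `p` on the translation are solved separately.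
  have h4 : ∃ t ∈ ({1, 2, 4} : Finset ℕ), ∀ s : ℕ, s % 2 = 1 → ∃ j : ℤ,
      (4 : ℤ) ∣ r + r * ((t * s : ℕ) : ℤ) * j - ((t * s : ℕ) : ℤ) * d := by
    have hr4 : r % 4 = 0 ∨ r % 4 = 2 ∨ r % 2 = 1 := by omega
    rcases hr4 with h | h | h
    · refine ⟨4, by simp, fun s _ => ⟨0, ?_⟩⟩
      push_cast
      refine Dvd.dvd.sub ?_ ⟨s * d, by ring⟩
      exact Dvd.dvd.add (Int.dvd_of_emod_eq_zero h) (by simp)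
    · refine ⟨2, by simp, fun s hs => ⟨0, ?_⟩⟩
      have hd2 : d % 2 = 1 := by
        by_contra hcon
        have h1 : (2 : ℤ) ∣ d := by omega
        have h2 : (2 : ℤ) ∣ r := by omega
        have := Dvd.dvd.sub (h1.mul_left (γ 0 0)) (h2.mul_left (γ 0 1))
        rw [hdet] at this
        omega
      have hsd : ((s : ℤ) * d) % 2 = 1 := by
        rw [Int.mul_emod, hd2]
        omega
      push_cast
      rw [show r + r * (2 * s) * 0 - 2 * s * d = r - 2 * ((s : ℤ) * d) by ring]
      omega
    · refine ⟨1, by simp, fun s hs => ?_⟩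
      have hodd' : IsCoprime (r * (s : ℤ)) 4 := by
        have h1 : IsCoprime (r * (s : ℤ)) 2 := by
          have : (r * (s : ℤ)) % 2 = 1 := by rw [Int.mul_emod, h]; omega
          exact ⟨1, -(r * (s : ℤ) / 2), by omega⟩
        have := h1.pow_right (n := 2)
        norm_num at this
        exact this
      obtain ⟨a, b, hab⟩ := hodd'
      refine ⟨a * (s * d - r), b * (s * d - r) * (-1), ?_⟩
      push_cast
      linear_combination (s * d - r) * hab
  have hp' : ∃ s ∈ ({1, p} : Finset ℕ), ∀ t ∈ ({1, 2, 4} : Finset ℕ), ∃ j : ℤ,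
      (p : ℤ) ∣ r + r * ((t * s : ℕ) : ℤ) * j - ((t * s : ℕ) : ℤ) * d := by
    by_cases hpr : (p : ℤ) ∣ r
    · refine ⟨p, by simp, fun t _ => ⟨0, ?_⟩⟩
      push_cast
      refine Dvd.dvd.sub ?_ ⟨t * d, by ring⟩
      exact Dvd.dvd.add hpr (by simp)
    · refine ⟨1, by simp, fun t ht => ?_⟩
      have hpZ : Prime (p : ℤ) := Nat.prime_iff_prime_int.1 hp
      have hpt : ¬ (p : ℤ) ∣ t := by
        intro hdvd
        have h4 : (t : ℤ) ∣ 2 ^ 2 := by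
          simp only [Finset.mem_insert, Finset.mem_singleton] at ht
          rcases ht with rfl | rfl | rfl <;> norm_num
        have h5 := hpZ.dvd_of_dvd_pow (hdvd.trans h4)
        have h6 : p ∣ 2 := by exact_mod_cast h5
        exact hp2 ((Nat.prime_dvd_prime_iff_eq hp Nat.prime_two).1 h6)
      have hcop : IsCoprime (r * (t : ℤ)) p := by
        refine IsCoprime.symm ((Prime.coprime_iff_not_dvd hpZ).2 ?_)
        exact fun hdvd => (hpZ.dvd_or_dvd hdvd).elim hpr hpt
      obtain ⟨a, b, hab⟩ := hcop
      refine ⟨a * (t * d - r), b * (t * d - r) * (-1), ?_⟩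
      push_cast
      linear_combination (t * d - r) * hab
  obtain ⟨t, ht, H4⟩ := h4
  obtain ⟨s, hs, Hp⟩ := hp'
  have hs2 : s % 2 = 1 := by
    simp only [Finset.mem_insert, Finset.mem_singleton] at hs
    rcases hs with rfl | rfl <;> omega
  obtain ⟨j₁, hj₁⟩ := H4 s hs2
  obtain ⟨j₂, hj₂⟩ := Hp t ht
  have hcop : IsCoprime (4 : ℤ) p := by
    have : Nat.Coprime 4 p := by
      rw [show 4 = 2 ^ 2 by norm_num]
      exact Nat.Coprime.pow_left 2 ((Nat.coprime_primes Nat.prime_two hp).2 (Ne.symm hp2))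
    exact_mod_cast Nat.isCoprime_iff_coprime.2 this
  obtain ⟨a, b, hab⟩ := hcop
  refine ⟨t, ht, s, hs, j₁ + 4 * a * (j₂ - j₁), ?_⟩
  push_cast at hj₁ hj₂ ⊢
  refine IsCoprime.mul_dvd ⟨a, b, hab⟩ ?_ ?_
  · have := Dvd.dvd.add hj₁ (Dvd.intro (r * (t * s) * (a * (j₂ - j₁))) rfl : (4 : ℤ) ∣ 4 * _)
    convert this using 1
    ring
  · have := Dvd.dvd.sub hj₂ (Dvd.intro (r * (t * s) * (b * (j₂ - j₁))) rfl : (p : ℤ) ∣ p * _)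
    convert this using 1
    linear_combination r * (t * s) * (j₂ - j₁) * hab

/-- A function that transforms under `Γ₀(4p)` by scalars vanishes at all cusps as soon as it does
so at the six cusps `1 / c`, `c ∣ 4p`. -/
lemma isZeroAtImInfty_slash {p : ℕ} (hp : p.Prime) (hp2 : p ≠ 2) {w : ℤ} {f : ℍ → ℂ}
    {ψ : SL(2, ℤ) → ℂ} (hf : ∀ γ ∈ Gamma0 (4 * p), f ∣[w] γ = ψ γ • f)
    (h0 : ∀ t ∈ ({1, 2, 4} : Finset ℕ), ∀ s ∈ ({1, p} : Finset ℕ),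
      Tendsto (f ∣[w] cuspRep (t * s)) atImInfty (𝓝 0)) (γ : SL(2, ℤ)) :
    IsZeroAtImInfty (f ∣[w] γ) := by
  obtain ⟨t, ht, s, hs, j, γ₀, hγ₀, rfl⟩ := exists_eq_mul_cuspRep_mul_T hp hp2 γ
  rw [SlashAction.slash_mul, SlashAction.slash_mul, hf γ₀ hγ₀, ModularForm.SL_smul_slash]
  have h1 := ((h0 t ht s hs).const_smul (ψ γ₀)).comp (tendsto_vadd_atImInfty j)
  rw [smul_zero] at h1
  refine h1.congr fun τ => ?_
  rw [slash_T_zpow_apply]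
  rfl

/-- The parabolic element `(1, 0; c, 1) T^h (1, 0; c, 1)⁻¹` lies in `Γ₀(N)` as soon as `N ∣ c² h`,
and its lower right entry is `1 + c h`; it acts on the translate of `f` to the cusp `1 / c` as the
translation by `h`. -/
lemma cuspRep_slash_vadd {N : ℕ} {w : ℤ} {f : ℍ → ℂ} {ψ : ℤ → ℂ}
    (hf : ∀ γ ∈ Gamma0 N, f ∣[w] γ = ψ (γ 1 1) • f) {c h : ℕ} (hch : N ∣ c ^ 2 * h) (τ : ℍ) :
    (f ∣[w] cuspRep c) ((h : ℝ) +ᵥ τ) = ψ (1 + c * h) * (f ∣[w] cuspRep c) τ := by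
  set γ : SL(2, ℤ) := cuspRep c * ModularGroup.T ^ (h : ℤ) * (cuspRep c)⁻¹ with hγ
  have hcoe : γ.1 = !![1 - (c : ℤ) * h, (h : ℤ); -((c : ℤ) ^ 2 * h), 1 + c * h] := by
    rw [hγ, Matrix.SpecialLinearGroup.coe_mul, Matrix.SpecialLinearGroup.coe_mul, coe_cuspRep_inv,
      ModularGroup.coe_T_zpow, coe_cuspRep]
    ext i j
    fin_cases i <;> fin_cases j <;> simp [Matrix.mul_apply, Fin.sum_univ_two] <;> ring
  have hmem : γ ∈ Gamma0 N := by
    rw [Gamma0_mem, ZMod.intCast_zmod_eq_zero_iff_dvd, hcoe]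
    simp only [Matrix.of_apply, Matrix.cons_val', Matrix.cons_val_zero, Matrix.cons_val_one,
      dvd_neg]
    exact_mod_cast hch
  have h1 := hf γ hmem
  have h2 : cuspRep c * ModularGroup.T ^ (h : ℤ) = γ * cuspRep c := by simp [hγ]
  have h3 : (f ∣[w] cuspRep c) ∣[w] (ModularGroup.T ^ (h : ℤ)) =
      ψ (γ 1 1) • (f ∣[w] cuspRep c) := by
    rw [← SlashAction.slash_mul, h2, SlashAction.slash_mul, h1, ModularForm.SL_smul_slash]
  have h4 := congrFun h3 τ
  rw [slash_T_zpow_apply, hcoe] at h4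
  simpa using h4

lemma MDiff_slash_SL {f : ℍ → ℂ} (hol : MDiff f) (w : ℤ) (γ : SL(2, ℤ)) : MDiff (f ∣[w] γ) :=
  hol.slash w _

lemma cuspWidth_pos {N c : ℕ} (hN : 0 < N) : 0 < cuspWidth N c :=
  Nat.div_pos (Nat.le_of_dvd hN (Nat.gcd_dvd_right _ _)) (Nat.gcd_pos_of_pos_right _ hN)

lemma dvd_sq_mul_cuspWidth (N c : ℕ) : N ∣ c ^ 2 * cuspWidth N c := by
  rw [cuspWidth, ← Nat.mul_div_assoc _ (Nat.gcd_dvd_right _ _), mul_comm,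
    Nat.mul_div_assoc _ (Nat.gcd_dvd_left _ _)]
  exact Dvd.intro _ rfl

/-- At a regular cusp the value of the form exists as a limit and is the constant term of the
Fourier expansion. -/
lemma tendsto_constTerm {p w c : ℕ} (hp : 0 < p) {f : ℍ → ℂ} {ψ : ℤ → ℂ}
    (hf : ∀ γ ∈ Gamma0 (4 * p), f ∣[(w : ℤ)] γ = ψ (γ 1 1) • f) (hol : MDiff f)
    (hb : IsBoundedAtImInfty (f ∣[(w : ℤ)] cuspRep c))
    (hψ : ψ (1 + c * cuspWidth (4 * p) c) = 1) :
    Tendsto (f ∣[(w : ℤ)] cuspRep c) atImInfty (𝓝 (constTerm p w c f)) := by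
  rw [constTerm, fourierCoeffAtCusp, transformAtCusp_eq_slash]
  refine tendsto_coeff_zero_qExpansion (Nat.cast_pos.2 (cuspWidth_pos (by omega))) (fun τ => ?_)
    (MDiff_slash_SL hol _ _) hb
  rw [cuspRep_slash_vadd hf (dvd_sq_mul_cuspWidth _ _), hψ, one_mul]

/-! ### The operator `τ ↦ dτ` -/

/-- The point `dτ` of the upper half plane. -/
def scalePoint (d : ℕ) [NeZero d] (τ : ℍ) : ℍ :=
  ⟨d * τ, by simpa using mul_pos (Nat.cast_pos.2 (NeZero.pos d)) τ.im_pos⟩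

@[simp] lemma coe_scalePoint (d : ℕ) [NeZero d] (τ : ℍ) :
    (scalePoint d τ : ℂ) = d * τ := rfl

/-- The function `τ ↦ F(dτ)`. -/
def scale (d : ℕ) [NeZero d] (F : ℍ → ℂ) (τ : ℍ) : ℂ := F (scalePoint d τ)

lemma MDiff_scale (d : ℕ) [NeZero d] {F : ℍ → ℂ} (hF : MDiff F) : MDiff (scale d F) := by
  rw [UpperHalfPlane.mdifferentiable_iff] at hF ⊢
  have hd : (0 : ℝ) < d := Nat.cast_pos.2 (NeZero.pos d)
  have hmaps : Set.MapsTo (fun z : ℂ => (d : ℂ) * z) {z | 0 < z.im} {z | 0 < z.im} := by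
    intro z hz
    simpa using mul_pos hd hz
  refine (hF.comp (f := fun z : ℂ => (d : ℂ) * z) (by fun_prop) hmaps).congr fun z hz => ?_
  have h1 : 0 < ((d : ℂ) * z).im := hmaps hz
  simp only [Function.comp_apply, scale, ofComplex_apply_of_im_pos h1]
  congr 1
  ext
  rw [coe_scalePoint, ofComplex_apply_of_im_pos hz]

/-- The commutation rule between scaling and slashing, for matrices related by
`(d, 0; 0, 1) γ = γ' (u, v; 0, x)`. -/
lemma scale_slash {d : ℕ} [NeZero d] {w : ℤ} {F : ℍ → ℂ} {γ γ' : SL(2, ℤ)} {u v x : ℤ}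
    (hx : 0 < x)
    (h00 : d * γ 0 0 = γ' 0 0 * u) (h01 : d * γ 0 1 = γ' 0 0 * v + γ' 0 1 * x)
    (h10 : γ 1 0 = γ' 1 0 * u) (h11 : γ 1 1 = γ' 1 0 * v + γ' 1 1 * x)
    (τ τ' : ℍ) (hτ' : (τ' : ℂ) = (u * τ + v) / x) :
    (scale d F ∣[w] γ) τ = (x : ℂ) ^ (-w) * (F ∣[w] γ') τ' := by
  have hx' : (x : ℂ) ≠ 0 := by exact_mod_cast hx.ne'
  have hden : (γ 1 0 : ℂ) * τ + (γ 1 1 : ℂ) = x * ((γ' 1 0 : ℂ) * τ' + (γ' 1 1 : ℂ)) := by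
    rw [h10, h11, hτ']
    push_cast
    field_simp
    ring
  have hnum : (d : ℂ) * ((γ 0 0 : ℂ) * τ + (γ 0 1 : ℂ)) =
      x * ((γ' 0 0 : ℂ) * τ' + (γ' 0 1 : ℂ)) := by
    have e0 : (d : ℂ) * (γ 0 0 : ℂ) = γ' 0 0 * u := by exact_mod_cast h00
    have e1 : (d : ℂ) * (γ 0 1 : ℂ) = γ' 0 0 * v + γ' 0 1 * x := by exact_mod_cast h01
    rw [mul_add, ← mul_assoc, e0, e1, hτ']
    field_simp
    ring
  have hpt : scalePoint d (γ • τ) = γ' • τ' := by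
    ext
    rw [coe_scalePoint, coe_smul_entries, coe_smul_entries, hden, ← mul_div_assoc, hnum,
      mul_div_mul_left _ _ hx']
  rw [slash_apply_entries, slash_apply_entries, scale, hpt, hden, mul_zpow]
  ring

/-- `Γ₀(dM)` is conjugated into `Γ₀(M)` by `(d, 0; 0, 1)`. -/
lemma exists_scale_slash_eq {d M : ℕ} [NeZero d] {γ : SL(2, ℤ)} (hγ : γ ∈ Gamma0 (M * d)) :
    ∃ γ' ∈ Gamma0 M, γ' 1 1 = γ 1 1 ∧
      ∀ (w : ℤ) (F : ℍ → ℂ), scale d F ∣[w] γ = scale d (F ∣[w] γ') := by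
  rw [Gamma0_mem, ZMod.intCast_zmod_eq_zero_iff_dvd] at hγ
  obtain ⟨m, hm⟩ := hγ
  have hdet : γ 0 0 * γ 1 1 - γ 0 1 * γ 1 0 = 1 := by
    have := γ.det_coe
    rwa [Matrix.det_fin_two] at this
  let γ' : SL(2, ℤ) := ⟨!![γ 0 0, d * γ 0 1; M * m, γ 1 1], by
    rw [Matrix.det_fin_two_of]
    rw [hm] at hdet
    push_cast at hdet
    linear_combination hdet⟩
  have e : (γ' : Matrix (Fin 2) (Fin 2) ℤ) = !![γ 0 0, d * γ 0 1; M * m, γ 1 1] := rfl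
  refine ⟨γ', ?_, by simp [e], fun w F => ?_⟩
  · rw [Gamma0_mem, ZMod.intCast_zmod_eq_zero_iff_dvd, e]
    simp
  · ext τ
    rw [scale_slash (γ' := γ') (u := d) (v := 0) (x := 1) one_pos _ _ _ _ τ (scalePoint d τ)]
    · simp [scale]
    all_goals simp [e, hm]
    all_goals ring

lemma tendsto_affine_atImInfty {g : ℍ → ℍ} {u v x : ℝ} (hu : 0 < u) (hx : 0 < x)
    (hg : ∀ τ, (g τ : ℂ) = (u * τ + v) / x) : Tendsto g atImInfty atImInfty := by
  have him : ∀ τ, (g τ).im = u / x * τ.im := fun τ => by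
    rw [← coe_im, hg, Complex.div_ofReal_im]
    simp
    ring
  rw [atImInfty]
  refine tendsto_comap_iff.2 ?_
  simp only [Function.comp_def, him]
  exact Tendsto.const_mul_atTop (div_pos hu hx) tendsto_comap

/-- The value at the cusp `1 / (u c)` of `τ ↦ F(u d τ)`, for coprime `c` and `d`. -/
lemma tendsto_scale_slash_cuspRep {u d c : ℕ} [NeZero (u * d)] {w : ℤ} {F : ℍ → ℂ} {L : ℂ}
    (hdc : Nat.Coprime d c)
    (hF : ∀ γ : SL(2, ℤ), γ 0 0 = d → γ 1 0 = c → Tendsto (F ∣[w] γ) atImInfty (𝓝 L)) :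
    Tendsto (scale (u * d) F ∣[w] cuspRep (u * c)) atImInfty (𝓝 ((d : ℂ) ^ (-w) * L)) := by
  have hud := NeZero.pos (u * d)
  have hu : 0 < u := Nat.pos_of_mul_pos_right hud
  have hd : 0 < d := Nat.pos_of_mul_pos_left hud
  obtain ⟨a, b, hab⟩ := Nat.isCoprime_iff_coprime.2 hdc
  let γ' : SL(2, ℤ) := ⟨!![(d : ℤ), -b; c, a], by
    rw [Matrix.det_fin_two_of]
    linear_combination hab⟩
  have e : (γ' : Matrix (Fin 2) (Fin 2) ℤ) = !![(d : ℤ), -b; c, a] := rfl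
  let g : ℍ → ℍ := fun τ => ⟨((u : ℝ) * τ + (b : ℝ)) / (d : ℝ), by
    rw [Complex.div_ofReal_im]
    simpa using div_pos (mul_pos (Nat.cast_pos.2 hu) τ.im_pos) (Nat.cast_pos.2 hd)⟩
  have hg : Tendsto g atImInfty atImInfty :=
    tendsto_affine_atImInfty (Nat.cast_pos.2 hu) (Nat.cast_pos.2 hd) fun τ => rfl
  have hlim := ((hF γ' (by simp [e]) (by simp [e])).comp hg).const_mul ((d : ℂ) ^ (-w))
  refine hlim.congr fun τ => ?_
  rw [scale_slash (γ' := γ') (u := u) (v := b) (x := d) (by exact_mod_cast hd) _ _ _ _ τ (g τ)]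
  · simp
  · simp [g]
  · simp [e]; ring
  · simp [e]; ring
  · simp [e]; ring
  · simp [e]; linear_combination -hab

/-! ### Cusp forms from vanishing at the cusps -/

/-- The cusp form given by a holomorphic function that is invariant under `Γ`, all of whose
`SL(2, ℤ)`-translates vanish at `∞`. -/
def mkCuspForm (Γ : Subgroup SL(2, ℤ)) [Γ.FiniteIndex] (w : ℤ) (f : ℍ → ℂ)
    (hf : ∀ γ ∈ Γ, f ∣[w] γ = f) (hol : MDiff f)
    (h0 : ∀ γ : SL(2, ℤ), IsZeroAtImInfty (f ∣[w] γ)) :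
    CuspForm (Γ : Subgroup (GL (Fin 2) ℝ)) w where
  toFun := f
  slash_action_eq' := by
    rintro _ ⟨γ, hγ, rfl⟩
    exact hf γ hγ
  holo' := hol
  zero_at_cusps' {c} hc := by
    rw [Subgroup.IsArithmetic.isCusp_iff_isCusp_SL2Z] at hc
    rw [OnePoint.isZeroAt_iff_forall_SL2Z hc]
    exact fun γ _ => h0 γ

@[simp] lemma coe_mkCuspForm (Γ : Subgroup SL(2, ℤ)) [Γ.FiniteIndex] (w : ℤ) (f : ℍ → ℂ)
    (hf : ∀ γ ∈ Γ, f ∣[w] γ = f) (hol : MDiff f)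
    (h0 : ∀ γ : SL(2, ℤ), IsZeroAtImInfty (f ∣[w] γ)) :
    ⇑(mkCuspForm Γ w f hf hol h0) = f := rfl

/-! ### Even weight -/

lemma eisensteinE_eq_E {w : ℕ} (hw : 3 ≤ w) (hw2 : Even w) (τ : ℍ) :
    eisensteinE w τ = ModularForm.E hw τ := by
  rw [EisensteinSeries.q_expansion_bernoulli hw hw2, eisensteinE]
  simp [nome]

lemma E_slash {w : ℕ} (hw : 3 ≤ w) (γ : SL(2, ℤ)) :
    (ModularForm.E hw : ℍ → ℂ) ∣[(w : ℤ)] γ = ModularForm.E hw :=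
  SlashInvariantFormClass.slash_action_eq (ModularForm.E hw) _ ⟨γ, rfl⟩

lemma tendsto_E {w : ℕ} (hw : 3 ≤ w) (hw2 : Even w) :
    Tendsto (ModularForm.E hw : ℍ → ℂ) atImInfty (𝓝 1) := by
  have h := tendsto_coeff_zero_qExpansion one_pos (g := ModularForm.E hw)
    (fun τ => SlashInvariantForm.vAdd_apply_of_mem_strictPeriods (ModularForm.E hw) τ
      one_mem_strictPeriods_SL)
    (ModularFormClass.holo _) (ModularFormClass.bdd_at_infty _)
  rwa [EisensteinSeries.E_qExpansion_coeff_zero hw hw2] at h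

lemma scale_E_slash {w d N : ℕ} [NeZero d] (hw : 3 ≤ w) (hd : d ∣ N) {γ : SL(2, ℤ)}
    (hγ : γ ∈ Gamma0 N) :
    scale d (ModularForm.E hw) ∣[(w : ℤ)] γ = scale d (ModularForm.E hw) := by
  obtain ⟨M, rfl⟩ := hd
  rw [mul_comm] at hγ
  obtain ⟨γ', -, -, h⟩ := exists_scale_slash_eq hγ
  rw [h, E_slash]

/-- The value of `E_w(dτ)` at the cusp `1 / c` is `(gcd(c, d) / d) ^ w`. -/
lemma tendsto_scale_E {w d c : ℕ} [NeZero d] (hw : 3 ≤ w) (hw2 : Even w) (u d' c' : ℕ)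
    (hd : d = u * d') (hc : c = u * c') (hcop : Nat.Coprime d' c') :
    Tendsto (scale d (ModularForm.E hw) ∣[(w : ℤ)] cuspRep c) atImInfty
      (𝓝 (((d' : ℂ) ^ w)⁻¹)) := by
  subst hd hc
  have := tendsto_scale_slash_cuspRep (u := u) (d := d') (c := c') (w := w)
    (F := ModularForm.E hw) (L := 1) hcop fun γ _ _ => by
      rw [E_slash]
      exact tendsto_E hw hw2
  simpa using this

lemma chiP_eq_one_or {p : ℕ} (hp : p % 2 = 1) : chiP p = 1 ∨ chiP p = -1 := by
  have h4 : p % 4 = 1 ∨ p % 4 = 3 := by omega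
  rcases h4 with h | h
  · left
    simp [chiP, chiNegFour, MulChar.ringHomComp_apply, ZMod.χ₄_nat_one_mod_four h]
  · right
    simp [chiP, chiNegFour, MulChar.ringHomComp_apply, ZMod.χ₄_nat_three_mod_four h]

lemma two_pow_sub_one_ne_zero {w : ℕ} (hw : w ≠ 0) : (2 ^ w - 1 : ℂ) ≠ 0 := by
  have : (2 : ℕ) ^ w ≠ 1 := (Nat.one_lt_pow hw (by norm_num)).ne'
  rw [sub_ne_zero]
  exact_mod_cast this

lemma pChi_pow_sub_one_ne_zero {p w : ℕ} (hp : p.Prime) (hp2 : p ≠ 2) (hw : w ≠ 0) :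
    pChi p ^ w - 1 ≠ 0 := by
  intro h
  have hodd : p % 2 = 1 := hp.eq_two_or_odd.resolve_left hp2
  have h1 : ‖pChi p‖ = p := by
    rcases chiP_eq_one_or hodd with h | h <;> simp [pChi, h]
  have h2 : (p : ℝ) ^ w = 1 := by
    rw [← h1, ← norm_pow, sub_eq_zero.1 h, norm_one]
  have h3 : p ^ w = 1 := by exact_mod_cast h2
  exact (Nat.one_lt_pow hw hp.one_lt).ne' h3

lemma even_weight_decomposition {k p : ℕ} (hk : 1 < k) (hp : p.Prime) (hp2 : p ≠ 2)
    (f : ModularForm (Gamma0 (4 * p) : Subgroup (GL (Fin 2) ℝ)) ((2 * k : ℕ) : ℤ)) :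
    ∃ C : CuspForm (Gamma0 (4 * p) : Subgroup (GL (Fin 2) ℝ)) ((2 * k : ℕ) : ℤ),
      ∀ τ : ℍ,
        f τ =
          (2 ^ (2 * k) * coeffB (2 * k) p 1 f - coeffB (2 * k) p 2 f) *
              eisensteinE (2 * k) τ
          + (-2 ^ (2 * k) * coeffB (2 * k) p 1 f + (2 ^ (2 * k) + 1) * coeffB (2 * k) p 2 f
              - coeffB (2 * k) p 4 f) * eisensteinE (2 * k) (2 * τ)
          + (-2 ^ (2 * k) * (coeffB (2 * k) p 2 f - coeffB (2 * k) p 4 f)) *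
              eisensteinE (2 * k) (4 * τ)
          + (-(p : ℂ) ^ (2 * k) * (2 ^ (2 * k) * coeffA (2 * k) p 1 f
              - coeffA (2 * k) p 2 f)) * eisensteinE (2 * k) (p * τ)
          + ((p : ℂ) ^ (2 * k) * (2 ^ (2 * k) * coeffA (2 * k) p 1 f
              - (2 ^ (2 * k) + 1) * coeffA (2 * k) p 2 f + coeffA (2 * k) p 4 f)) *
              eisensteinE (2 * k) (2 * p * τ)
          + ((2 * p : ℂ) ^ (2 * k) * (coeffA (2 * k) p 2 f - coeffA (2 * k) p 4 f)) *
              eisensteinE (2 * k) (4 * p * τ)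
          + C τ := by
  have hodd : p % 2 = 1 := hp.eq_two_or_odd.resolve_left hp2
  have : NeZero p := ⟨hp.ne_zero⟩
  have hw : 3 ≤ 2 * k := by omega
  have hw2 : Even (2 * k) := even_two_mul k
  have c2p : Nat.Coprime 2 p := (Nat.coprime_primes Nat.prime_two hp).2 (Ne.symm hp2)
  have c4p : Nat.Coprime 4 p := c2p.pow_left 2
  set b1 := 2 ^ (2 * k) * coeffB (2 * k) p 1 f - coeffB (2 * k) p 2 f with hb1
  set b2 := -2 ^ (2 * k) * coeffB (2 * k) p 1 f + (2 ^ (2 * k) + 1) * coeffB (2 * k) p 2 f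
              - coeffB (2 * k) p 4 f with hb2
  set b4 := -2 ^ (2 * k) * (coeffB (2 * k) p 2 f - coeffB (2 * k) p 4 f) with hb4
  set bp := -(p : ℂ) ^ (2 * k) * (2 ^ (2 * k) * coeffA (2 * k) p 1 f
              - coeffA (2 * k) p 2 f) with hbp
  set b2p := (p : ℂ) ^ (2 * k) * (2 ^ (2 * k) * coeffA (2 * k) p 1 f
              - (2 ^ (2 * k) + 1) * coeffA (2 * k) p 2 f + coeffA (2 * k) p 4 f) with hb2p
  set b4p := (2 * p : ℂ) ^ (2 * k) * (coeffA (2 * k) p 2 f - coeffA (2 * k) p 4 f) with hb4p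
  set E : ℍ → ℂ := ⇑(ModularForm.E hw) with hE
  have hEol : MDiff E := ModularFormClass.holo (ModularForm.E hw)
  have hfinv : ∀ γ ∈ Gamma0 (4 * p), (f : ℍ → ℂ) ∣[((2 * k : ℕ) : ℤ)] γ = f := fun γ hγ =>
    SlashInvariantFormClass.slash_action_eq f _ ⟨γ, hγ, rfl⟩
  set G : ℍ → ℂ := b1 • scale 1 E + b2 • scale 2 E + b4 • scale 4 E + bp • scale p E
    + b2p • scale (2 * p) E + b4p • scale (4 * p) E with hG
  have hGol : MDiff G := by
    have h (d : ℕ) [NeZero d] (b : ℂ) : MDiff (b • scale d E) := (MDiff_scale d hEol).const_smul b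
    exact (((((h 1 b1).add (h 2 b2)).add (h 4 b4)).add (h p bp)).add (h (2 * p) b2p)).add
      (h (4 * p) b4p)
  have hGslash (γ : SL(2, ℤ)) : G ∣[((2 * k : ℕ) : ℤ)] γ =
      b1 • (scale 1 E ∣[((2 * k : ℕ) : ℤ)] γ) + b2 • (scale 2 E ∣[((2 * k : ℕ) : ℤ)] γ)
      + b4 • (scale 4 E ∣[((2 * k : ℕ) : ℤ)] γ) + bp • (scale p E ∣[((2 * k : ℕ) : ℤ)] γ)
      + b2p • (scale (2 * p) E ∣[((2 * k : ℕ) : ℤ)] γ)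
      + b4p • (scale (4 * p) E ∣[((2 * k : ℕ) : ℤ)] γ) := by
    simp only [hG, SlashAction.add_slash, ModularForm.SL_smul_slash]
  have hGinv : ∀ γ ∈ Gamma0 (4 * p), G ∣[((2 * k : ℕ) : ℤ)] γ = G := fun γ hγ => by
    rw [hGslash, scale_E_slash hw (one_dvd _) hγ,
      scale_E_slash hw (Dvd.intro (2 * p) (by ring)) hγ, scale_E_slash hw (Dvd.intro _ rfl) hγ,
      scale_E_slash hw (Dvd.intro_left _ rfl) hγ, scale_E_slash hw (Dvd.intro 2 (by ring)) hγ,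
      scale_E_slash hw dvd_rfl hγ]
  have hinv : ∀ γ ∈ Gamma0 (4 * p), (⇑f - G) ∣[((2 * k : ℕ) : ℤ)] γ = ⇑f - G := fun γ hγ => by
    rw [sub_eq_add_neg, SlashAction.add_slash, SlashAction.neg_slash, hfinv γ hγ, hGinv γ hγ]
  have hol : MDiff (⇑f - G) := (ModularFormClass.holo f).sub hGol
  have hconst (c : ℕ) : Tendsto (⇑f ∣[((2 * k : ℕ) : ℤ)] cuspRep c) atImInfty
      (𝓝 (constTerm p (2 * k) c f)) :=
    tendsto_constTerm (ψ := fun _ => 1) hp.pos (fun γ hγ => by rw [hfinv γ hγ, one_smul])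
      (ModularFormClass.holo f) (ModularFormClass.bdd_at_infty_slash f _) rfl
  -- The value at a cusp of the difference, from the values of the six Eisenstein series there.
  have key (c e1 e2 e4 ep e2p e4p : ℕ)
      (h1 : Tendsto (scale 1 E ∣[((2 * k : ℕ) : ℤ)] cuspRep c) atImInfty
        (𝓝 (((e1 : ℂ) ^ (2 * k))⁻¹)))
      (h2 : Tendsto (scale 2 E ∣[((2 * k : ℕ) : ℤ)] cuspRep c) atImInfty
        (𝓝 (((e2 : ℂ) ^ (2 * k))⁻¹)))
      (h4 : Tendsto (scale 4 E ∣[((2 * k : ℕ) : ℤ)] cuspRep c) atImInfty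
        (𝓝 (((e4 : ℂ) ^ (2 * k))⁻¹)))
      (hp : Tendsto (scale p E ∣[((2 * k : ℕ) : ℤ)] cuspRep c) atImInfty
        (𝓝 (((ep : ℂ) ^ (2 * k))⁻¹)))
      (h2p : Tendsto (scale (2 * p) E ∣[((2 * k : ℕ) : ℤ)] cuspRep c) atImInfty
        (𝓝 (((e2p : ℂ) ^ (2 * k))⁻¹)))
      (h4p : Tendsto (scale (4 * p) E ∣[((2 * k : ℕ) : ℤ)] cuspRep c) atImInfty
        (𝓝 (((e4p : ℂ) ^ (2 * k))⁻¹)))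
      (hv : constTerm p (2 * k) c f = b1 * ((e1 : ℂ) ^ (2 * k))⁻¹ + b2 * ((e2 : ℂ) ^ (2 * k))⁻¹
        + b4 * ((e4 : ℂ) ^ (2 * k))⁻¹ + bp * ((ep : ℂ) ^ (2 * k))⁻¹
        + b2p * ((e2p : ℂ) ^ (2 * k))⁻¹ + b4p * ((e4p : ℂ) ^ (2 * k))⁻¹) :
      Tendsto ((⇑f - G) ∣[((2 * k : ℕ) : ℤ)] cuspRep c) atImInfty (𝓝 0) := by
    have hlim := (hconst c).sub ((((((h1.const_smul b1).add (h2.const_smul b2)).add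
      (h4.const_smul b4)).add (hp.const_smul bp)).add (h2p.const_smul b2p)).add
      (h4p.const_smul b4p))
    simp only [smul_eq_mul] at hlim
    rw [← hv, sub_self] at hlim
    rw [sub_eq_add_neg, SlashAction.add_slash, SlashAction.neg_slash, ← sub_eq_add_neg, hGslash]
    exact hlim
  have hpw : (p : ℂ) ^ (2 * k) ≠ 0 := pow_ne_zero _ (Nat.cast_ne_zero.2 hp.ne_zero)
  have h2w : (2 : ℂ) ^ (2 * k) ≠ 0 := pow_ne_zero _ two_ne_zero
  have hA := two_pow_sub_one_ne_zero (w := 2 * k) (by omega)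
  have hPχ : pChi p ^ (2 * k) = (p : ℂ) ^ (2 * k) := by
    rcases chiP_eq_one_or hodd with h | h <;> simp [pChi, h]
  have hP := pChi_pow_sub_one_ne_zero (w := 2 * k) hp hp2 (by omega)
  rw [hPχ] at hP
  have hχ (t : ℕ) : chiP p ^ (t * (2 * k)) = 1 := by
    rcases chiP_eq_one_or hodd with h | h
    · rw [h, one_pow]
    · rw [h, Even.neg_one_pow (hw2.mul_left t)]
  have hχ1 : chiP p ^ (2 * k) = 1 := by rw [← one_mul (2 * k), hχ]
  have hfour : (4 : ℂ) ^ (2 * k) = (2 ^ (2 * k)) ^ 2 := by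
    rw [show (4 : ℂ) = 2 ^ 2 by norm_num, ← pow_mul, ← pow_mul, mul_comm]
  have hzero : ∀ t ∈ ({1, 2, 4} : Finset ℕ), ∀ s ∈ ({1, p} : Finset ℕ),
      Tendsto ((⇑f - G) ∣[((2 * k : ℕ) : ℤ)] cuspRep (t * s)) atImInfty (𝓝 0) := by
    simp only [Finset.mem_insert, Finset.mem_singleton, forall_eq_or_imp, forall_eq]
    have T := fun (d c : ℕ) [NeZero d] => tendsto_scale_E (d := d) (c := c) hw hw2
    have c24 : Nat.Coprime p 2 := c2p.symm
    have c44 : Nat.Coprime p 4 := c4p.symm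
    refine ⟨⟨key _ 1 2 4 p (2 * p) (4 * p)
        (T _ _ 1 1 1 ?_ ?_ ?_) (T _ _ 1 2 1 ?_ ?_ ?_) (T _ _ 1 4 1 ?_ ?_ ?_)
        (T _ _ 1 p 1 ?_ ?_ ?_) (T _ _ 1 (2 * p) 1 ?_ ?_ ?_) (T _ _ 1 (4 * p) 1 ?_ ?_ ?_) ?_,
      key _ 1 2 4 1 2 4
        (T _ _ 1 1 p ?_ ?_ ?_) (T _ _ 1 2 p ?_ ?_ ?_) (T _ _ 1 4 p ?_ ?_ ?_)
        (T _ _ p 1 1 ?_ ?_ ?_) (T _ _ p 2 1 ?_ ?_ ?_) (T _ _ p 4 1 ?_ ?_ ?_) ?_⟩,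
      ⟨key _ 1 1 2 p p (2 * p)
        (T _ _ 1 1 2 ?_ ?_ ?_) (T _ _ 2 1 1 ?_ ?_ ?_) (T _ _ 2 2 1 ?_ ?_ ?_)
        (T _ _ 1 p 2 ?_ ?_ ?_) (T _ _ 2 p 1 ?_ ?_ ?_) (T _ _ 2 (2 * p) 1 ?_ ?_ ?_) ?_,
      key _ 1 1 2 1 1 2
        (T _ _ 1 1 (2 * p) ?_ ?_ ?_) (T _ _ 2 1 p ?_ ?_ ?_) (T _ _ 2 2 p ?_ ?_ ?_)
        (T _ _ p 1 2 ?_ ?_ ?_) (T _ _ (2 * p) 1 1 ?_ ?_ ?_) (T _ _ (2 * p) 2 1 ?_ ?_ ?_) ?_⟩,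
      key _ 1 1 1 p p p
        (T _ _ 1 1 4 ?_ ?_ ?_) (T _ _ 2 1 2 ?_ ?_ ?_) (T _ _ 4 1 1 ?_ ?_ ?_)
        (T _ _ 1 p 4 ?_ ?_ ?_) (T _ _ 2 p 2 ?_ ?_ ?_) (T _ _ 4 p 1 ?_ ?_ ?_) ?_,
      key _ 1 1 1 1 1 1
        (T _ _ 1 1 (4 * p) ?_ ?_ ?_) (T _ _ 2 1 (2 * p) ?_ ?_ ?_) (T _ _ 4 1 p ?_ ?_ ?_)
        (T _ _ p 1 4 ?_ ?_ ?_) (T _ _ (2 * p) 1 2 ?_ ?_ ?_) (T _ _ (4 * p) 1 1 ?_ ?_ ?_) ?_⟩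
    all_goals first | ring1 | assumption | exact Nat.coprime_one_right _ |
      exact Nat.coprime_one_left _ | skip
    all_goals
      simp only [hb1, hb2, hb4, hbp, hb2p, hb4p, coeffA, coeffB, hPχ, hχ, hχ1, Nat.cast_mul,
        mul_pow, Nat.cast_ofNat, Nat.cast_one, one_pow, hfour, one_mul, mul_one]
      field_simp
      ring
  refine ⟨mkCuspForm (Gamma0 (4 * p)) _ (⇑f - G) hinv hol
    (isZeroAtImInfty_slash hp hp2 (ψ := fun _ => 1) (fun γ hγ => by rw [hinv γ hγ, one_smul])
      hzero), fun τ => ?_⟩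
  have hs (d : ℕ) [NeZero d] : scale d E τ = eisensteinE (2 * k) (d * τ) := by
    rw [scale, hE, ← eisensteinE_eq_E hw hw2, coe_scalePoint]
  simp only [coe_mkCuspForm, hG, Pi.sub_apply, Pi.add_apply, Pi.smul_apply, smul_eq_mul, hs]
  push_cast
  ring_nf

/-! ### Eisenstein series weighted by a function modulo `N` -/

section eisSum

variable {N : ℕ} [NeZero N]

/-- The Eisenstein series `∑ φ(m, n) (m z + n)^{-w}` over the coprime pairs `(m, n)`, for a
function `φ` of the residues of `m` and `n` modulo `N`. -/
def eisSum (w : ℤ) (φ : (Fin 2 → ZMod N) → ℂ) (z : ℍ) : ℂ :=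
  ∑ a, φ a * eisensteinSeries a w z

lemma eisSum_eq_sum (w : ℤ) (φ : (Fin 2 → ZMod N) → ℂ) :
    eisSum w φ = ∑ a, φ a • (eisensteinSeriesSIF a w : ℍ → ℂ) := by
  ext z
  simp [eisSum, eisensteinSeriesSIF_apply]

/-- The action of `SL(2, ℤ)` on the weighted Eisenstein series is its action on the weights. -/
lemma eisSum_slash (w : ℤ) (φ : (Fin 2 → ZMod N) → ℂ) (γ : SL(2, ℤ)) :
    eisSum w φ ∣[w] γ = eisSum w fun a => φ (a ᵥ* ((γ⁻¹ : SL(2, ℤ)) : SL(2, ZMod N))) := by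
  set A : Matrix (Fin 2) (Fin 2) (ZMod N) :=
    ((γ : SL(2, ZMod N)) : Matrix (Fin 2) (Fin 2) (ZMod N)) with hA
  set B : Matrix (Fin 2) (Fin 2) (ZMod N) :=
    (((γ⁻¹ : SL(2, ℤ)) : SL(2, ZMod N)) : Matrix (Fin 2) (Fin 2) (ZMod N)) with hB
  have hAB : A * B = 1 := by
    have h : ((γ : SL(2, ℤ)) : SL(2, ZMod N)) * ((γ⁻¹ : SL(2, ℤ)) : SL(2, ZMod N)) = 1 := by
      rw [← map_mul, mul_inv_cancel, map_one]
    exact congrArg Subtype.val h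
  have hBA : B * A = 1 := by
    have h : ((γ⁻¹ : SL(2, ℤ)) : SL(2, ZMod N)) * ((γ : SL(2, ℤ)) : SL(2, ZMod N)) = 1 := by
      rw [← map_mul, inv_mul_cancel, map_one]
    exact congrArg Subtype.val h
  let e : (Fin 2 → ZMod N) ≃ (Fin 2 → ZMod N) :=
    { toFun := fun a => a ᵥ* A
      invFun := fun a => a ᵥ* B
      left_inv := fun a => by
        simp only []
        rw [vecMul_vecMul, hAB, vecMul_one]
      right_inv := fun a => by
        simp only []
        rw [vecMul_vecMul, hBA, vecMul_one] }
  rw [eisSum_eq_sum, eisSum_eq_sum, SlashAction.sum_slash]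
  refine Fintype.sum_equiv e _ _ fun a => ?_
  rw [ModularForm.SL_smul_slash]
  congr 1
  · exact congrArg φ (e.left_inv a).symm
  · exact eisensteinSeries_slash_apply a w γ

lemma MDiff_eisSum {w : ℤ} (hw : 3 ≤ w) (φ : (Fin 2 → ZMod N) → ℂ) : MDiff (eisSum w φ) := by
  rw [eisSum_eq_sum]
  have (s : Finset (Fin 2 → ZMod N)) :
      MDiff (∑ a ∈ s, φ a • (eisensteinSeriesSIF a w : ℍ → ℂ)) := by
    classical
    induction s using Finset.induction_on with
    | empty =>
      rw [Finset.sum_empty]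
      exact mdifferentiable_const
    | insert a s ha ih =>
      rw [Finset.sum_insert ha]
      exact ((eisensteinSeriesSIF_mdifferentiable hw a).const_smul _).add ih
  exact this _

lemma isBoundedAtImInfty_eisSum {w : ℤ} (hw : 3 ≤ w) (φ : (Fin 2 → ZMod N) → ℂ) :
    IsBoundedAtImInfty (eisSum w φ) := by
  rw [eisSum_eq_sum]
  have (s : Finset (Fin 2 → ZMod N)) :
      IsBoundedAtImInfty (∑ a ∈ s, φ a • (eisensteinSeriesSIF a w : ℍ → ℂ)) := by
    classical
    induction s using Finset.induction_on with
    | empty =>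
      rw [Finset.sum_empty]
      exact zero_form_isBoundedAtImInfty
    | insert a s ha ih =>
      rw [Finset.sum_insert ha]
      refine Filter.BoundedAtFilter.add ?_ ih
      refine Filter.BoundedAtFilter.smul _ ?_
      have := isBoundedAtImInfty_eisensteinSeriesSIF a hw 1
      rwa [SlashAction.slash_one] at this
  exact this _

lemma eisSum_vadd (w : ℤ) (φ : (Fin 2 → ZMod N) → ℂ) (z : ℍ) :
    eisSum w φ ((N : ℝ) +ᵥ z) = eisSum w φ z := by
  rw [eisSum, eisSum]
  refine Finset.sum_congr rfl fun a _ => ?_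
  have := SlashInvariantForm.vAdd_width_periodic N w 1 (eisensteinSeriesSIF a w) z
  simp only [Int.cast_one, mul_one, eisensteinSeriesSIF_apply] at this
  rw [this]

lemma eisSum_eq_tsum {w : ℤ} (hw : 3 ≤ w) (φ : (Fin 2 → ZMod N) → ℂ) (z : ℍ) :
    eisSum w φ z = ∑' v : gammaSet 1 1 0,
      φ (fun i => ((v : Fin 2 → ℤ) i : ZMod N)) * eisSummand w v z := by
  classical
  have hs := (summable_norm_eisSummand hw z).of_norm
  have h1 (a : Fin 2 → ZMod N) : φ a * eisensteinSeries a w z =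
      ∑' v : Fin 2 → ℤ, φ a * (gammaSet N 1 a).indicator (eisSummand w · z) v := by
    rw [eisensteinSeries, tsum_mul_left, tsum_subtype (gammaSet N 1 a) (eisSummand w · z)]
  rw [eisSum, Finset.sum_congr rfl fun a _ => h1 a,
    tsum_subtype (gammaSet 1 1 0) fun v : Fin 2 → ℤ =>
      φ (fun i => (v i : ZMod N)) * eisSummand w v z,
    ← Summable.tsum_finsetSum fun a _ => (hs.indicator _).mul_left _]
  refine tsum_congr fun v => ?_
  rw [Finset.sum_eq_single (fun i => (v i : ZMod N))]
  · by_cases hv : v ∈ gammaSet 1 1 0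
    · have hv' : v ∈ gammaSet N 1 (fun i => (v i : ZMod N)) := ⟨rfl, hv.2⟩
      rw [Set.indicator_of_mem hv, Set.indicator_of_mem hv']
    · have hv' : v ∉ gammaSet N 1 (fun i => (v i : ZMod N)) := fun h =>
        hv ⟨Subsingleton.elim _ _, h.2⟩
      rw [Set.indicator_of_notMem hv, Set.indicator_of_notMem hv', mul_zero]
  · intro a _ ha
    rw [Set.indicator_of_notMem (fun h => ha h.1.symm), mul_zero]
  · intro h
    exact absurd (Finset.mem_univ _) h

lemma tendsto_mul_I_atImInfty :
    Tendsto (fun y : ℝ => ofComplex (y * Complex.I)) atTop atImInfty := by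
  rw [atImInfty]
  refine tendsto_comap_iff.2 (tendsto_id.congr' ?_)
  filter_upwards [eventually_gt_atTop 0] with y hy
  have h : 0 < ((y : ℂ) * Complex.I).im := by simpa using hy
  simp [ofComplex_apply_of_im_pos h]

/-- The limit of an absolutely convergent weighted Eisenstein series along the imaginary axis:
only the terms independent of `z` contribute. -/
lemma tendsto_tsum_mul_eisSummand {w : ℕ} (hw : 3 ≤ w) {W : (Fin 2 → ℤ) → ℂ} {M : ℝ}
    (hW : ∀ v, ‖W v‖ ≤ M) :
    Tendsto (fun y : ℝ => ∑' v : Fin 2 → ℤ, W v * eisSummand w v (ofComplex (y * Complex.I)))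
      atTop (𝓝 (∑' v : Fin 2 → ℤ, W v * if v 0 = 0 then (v 1 : ℂ) ^ (-(w : ℤ)) else 0)) := by
  have hw' : (2 : ℝ) < (w : ℝ) := by exact_mod_cast hw
  have hM : 0 ≤ M := (norm_nonneg _).trans (hW 0)
  refine tendsto_tsum_of_dominated_convergence
    (bound := fun v => M * (r ⟨⟨0, 1⟩, one_pos⟩ ^ (-(w : ℝ)) * ‖v‖ ^ (-(w : ℝ)))) ?_ ?_ ?_
  · exact ((summable_one_div_norm_rpow hw').mul_left _).mul_left _
  · intro v
    refine Tendsto.const_mul _ ?_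
    by_cases hv : v 0 = 0
    · simp only [eisSummand, hv, if_true]
      simp
    · rw [if_neg hv]
      have hnorm : Tendsto (fun y : ℝ => ‖(v 0 : ℂ) * (y * Complex.I) + v 1‖) atTop atTop := by
        refine tendsto_atTop_mono (f := fun y : ℝ => |(v 0 : ℝ)| * |y|) (fun y => ?_) ?_
        · have := Complex.abs_im_le_norm ((v 0 : ℂ) * (y * Complex.I) + v 1)
          simpa [abs_mul] using this
        · exact tendsto_abs_atTop_atTop.const_mul_atTop (by simpa using hv)
      have h0 : Tendsto (fun y : ℝ => ((v 0 : ℂ) * (y * Complex.I) + v 1) ^ (-(w : ℤ))) atTop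
          (𝓝 0) := by
        rw [tendsto_zero_iff_norm_tendsto_zero]
        simp only [norm_zpow]
        exact (tendsto_zpow_atTop_zero (by omega)).comp hnorm
      refine h0.congr' ?_
      filter_upwards [eventually_gt_atTop 0] with y hy
      have h : 0 < ((y : ℂ) * Complex.I).im := by simpa using hy
      simp [eisSummand, ofComplex_apply_of_im_pos h]
  · filter_upwards [eventually_ge_atTop 1] with y hy v
    have h : 0 < ((y : ℂ) * Complex.I).im := by simpa using one_pos.trans_le hy
    have hstrip : (ofComplex (y * Complex.I)) ∈ verticalStrip 0 1 := by
      rw [ofComplex_apply_of_im_pos h, mem_verticalStrip_iff]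
      simpa [UpperHalfPlane.re, UpperHalfPlane.im] using hy
    rw [norm_mul]
    refine mul_le_mul (hW v) ?_ (norm_nonneg _) hM
    rw [eisSummand, norm_zpow]
    exact_mod_cast summand_bound_of_mem_verticalStrip (k := (w : ℝ)) (by positivity) v one_pos
      hstrip

/-- The value at `∞`. The limit exists by the Fourier expansion, so it can be computed on the
imaginary axis, where only the pairs `(0, 1)` and `(0, -1)` contribute. -/
lemma tendsto_eisSum {w : ℕ} (hw : 3 ≤ w) (hodd : Odd w) (φ : (Fin 2 → ZMod N) → ℂ) :
    Tendsto (eisSum w φ) atImInfty (𝓝 (φ ![0, 1] - φ ![0, -1])) := by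
  classical
  have hw' : (3 : ℤ) ≤ w := by exact_mod_cast hw
  have hL := tendsto_coeff_zero_qExpansion (Nat.cast_pos.2 (NeZero.pos N)) (eisSum_vadd w φ)
    (MDiff_eisSum hw' φ) (isBoundedAtImInfty_eisSum hw' φ)
  set W : (Fin 2 → ℤ) → ℂ :=
    (gammaSet 1 1 0).indicator fun v => φ fun i => (v i : ZMod N) with hWdef
  have hW : ∀ v, ‖W v‖ ≤ ∑ a, ‖φ a‖ := fun v => by
    refine (norm_indicator_le_norm_self _ _).trans ?_
    exact Finset.single_le_sum (f := fun a => ‖φ a‖) (fun _ _ => norm_nonneg _)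
      (Finset.mem_univ _)
  have hsum (z : ℍ) : eisSum w φ z = ∑' v : Fin 2 → ℤ, W v * eisSummand w v z := by
    rw [eisSum_eq_tsum hw', tsum_subtype (gammaSet 1 1 0) fun v : Fin 2 → ℤ =>
      φ (fun i => (v i : ZMod N)) * eisSummand w v z]
    refine tsum_congr fun v => ?_
    rw [hWdef, Set.indicator_mul_left]
  have hval : ∑' v : Fin 2 → ℤ, W v * (if v 0 = 0 then (v 1 : ℂ) ^ (-(w : ℤ)) else 0) =
      φ ![0, 1] - φ ![0, -1] := by
    rw [tsum_eq_sum (s := {![0, 1], ![0, -1]})]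
    · rw [Finset.sum_pair (by simp)]
      have m1 : (![0, 1] : Fin 2 → ℤ) ∈ gammaSet 1 1 0 := by simp [gammaSet_one_mem_iff]
      have m2 : (![0, -1] : Fin 2 → ℤ) ∈ gammaSet 1 1 0 := by simp [gammaSet_one_mem_iff]
      have e1 : (fun i => ((![0, 1] : Fin 2 → ℤ) i : ZMod N)) = ![0, 1] := by
        ext i; fin_cases i <;> simp
      have e2 : (fun i => ((![0, -1] : Fin 2 → ℤ) i : ZMod N)) = ![0, -1] := by
        ext i; fin_cases i <;> simp
      rw [hWdef, Set.indicator_of_mem m1, Set.indicator_of_mem m2, e1, e2]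
      simp [hodd.neg_one_pow, sub_eq_add_neg, inv_neg]
    · intro v hv
      by_cases h0 : v 0 = 0
      · have : v ∉ gammaSet 1 1 0 := by
          intro hmem
          rw [gammaSet_one_mem_iff, h0, Int.gcd_zero_left, Int.natAbs_eq_iff] at hmem
          apply hv
          rw [Finset.mem_insert, Finset.mem_singleton]
          refine hmem.imp (fun h => ?_) (fun h => ?_) <;>
          · ext i
            fin_cases i
            · exact h0
            · simpa using h
        rw [hWdef, Set.indicator_of_notMem this, zero_mul]
      · rw [if_neg h0, mul_zero]
  have hI := tendsto_tsum_mul_eisSummand hw hW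
  rw [hval] at hI
  simp only [← hsum] at hI
  rwa [tendsto_nhds_unique (hL.comp tendsto_mul_I_atImInfty) hI] at hL

omit [NeZero N] in
lemma coe_intCast_inv (γ : SL(2, ℤ)) :
    (((γ⁻¹ : SL(2, ℤ)) : SL(2, ZMod N)) : Matrix (Fin 2) (Fin 2) (ZMod N)) =
      !![(γ 1 1 : ZMod N), -γ 0 1; -γ 1 0, γ 0 0] := by
  rw [map_inv, Matrix.SpecialLinearGroup.coe_inv, Matrix.adjugate_fin_two]
  simp

lemma tendsto_eisSum_slash {w : ℕ} (hw : 3 ≤ w) (hodd : Odd w) (φ : (Fin 2 → ZMod N) → ℂ)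
    (γ : SL(2, ℤ)) :
    Tendsto (eisSum w φ ∣[(w : ℤ)] γ) atImInfty
      (𝓝 (φ ![-(γ 1 0 : ZMod N), γ 0 0] - φ ![(γ 1 0 : ZMod N), -γ 0 0])) := by
  rw [eisSum_slash]
  have h := tendsto_eisSum hw hodd
    fun a => φ (a ᵥ* ((γ⁻¹ : SL(2, ℤ)) : SL(2, ZMod N)))
  have e1 : (![0, 1] : Fin 2 → ZMod N) ᵥ* !![(γ 1 1 : ZMod N), -γ 0 1; -γ 1 0, γ 0 0] =
      ![-(γ 1 0 : ZMod N), γ 0 0] := by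
    ext i; fin_cases i <;> simp [vecMul]
  have e2 : (![0, -1] : Fin 2 → ZMod N) ᵥ* !![(γ 1 1 : ZMod N), -γ 0 1; -γ 1 0, γ 0 0] =
      ![(γ 1 0 : ZMod N), -γ 0 0] := by
    ext i; fin_cases i <;> simp [vecMul]
  rw [← coe_intCast_inv] at e1 e2
  rwa [e1, e2] at h

lemma summable_norm_mul_eisSummand {w : ℕ} (hw : 3 ≤ w) (φ : (Fin 2 → ZMod N) → ℂ) (z : ℍ) :
    Summable fun v : Fin 2 → ℤ => ‖φ (fun i => (v i : ZMod N)) * eisSummand w v z‖ := by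
  have hw' : (3 : ℤ) ≤ w := by exact_mod_cast hw
  refine ((summable_norm_eisSummand hw' z).mul_left (∑ a, ‖φ a‖)).of_nonneg_of_le
    (fun _ => norm_nonneg _) fun v => ?_
  rw [norm_mul]
  refine mul_le_mul_of_nonneg_right ?_ (norm_nonneg _)
  exact Finset.single_le_sum (f := fun a => ‖φ a‖) (fun _ _ => norm_nonneg _)
    (Finset.mem_univ _)

omit [NeZero N] in
lemma summable_norm_character_mul_inv_pow {w : ℕ} (hw : 1 < w) (χ : DirichletCharacter ℂ N) :
    Summable fun n : ℕ => ‖χ (n : ZMod N) * ((n : ℂ) ^ w)⁻¹‖ := by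
  refine (Real.summable_nat_pow_inv.2 hw).of_nonneg_of_le (fun _ => norm_nonneg _) fun n => ?_
  rw [norm_mul, norm_inv, norm_pow, Complex.norm_natCast]
  exact mul_le_of_le_one_left (by positivity) (χ.norm_le_one _)

omit [NeZero N] in
lemma tsum_gammaSet_mul_eisSummand {w : ℕ} (hw : w ≠ 0) {φ : (Fin 2 → ZMod N) → ℂ}
    {χ : DirichletCharacter ℂ N} (hφ : ∀ (g : ZMod N) a, φ (g • a) = χ g * φ a) (z : ℍ) (b : ℕ) :
    ∑' v : gammaSet 1 b 0, φ (fun i => ((v : Fin 2 → ℤ) i : ZMod N)) * eisSummand w v z =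
      χ (b : ZMod N) * ((b : ℂ) ^ w)⁻¹ *
        ∑' v : gammaSet 1 1 0, φ (fun i => ((v : Fin 2 → ℤ) i : ZMod N)) * eisSummand w v z := by
  have hv (v : gammaSet 1 b 0) : φ (fun i => ((v : Fin 2 → ℤ) i : ZMod N)) * eisSummand w v z =
      χ (b : ZMod N) * ((b : ℂ) ^ w)⁻¹ *
        (φ (fun i => ((divIntMap b (v : Fin 2 → ℤ)) i : ZMod N)) *
          eisSummand w (divIntMap b (v : Fin 2 → ℤ)) z) := by
    have e : (fun i => ((v : Fin 2 → ℤ) i : ZMod N)) =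
        (b : ZMod N) • fun i => ((divIntMap b (v : Fin 2 → ℤ)) i : ZMod N) := by
      ext i
      have := congrFun (gammaSet_eq_gcd_mul_divIntMap v.2) i
      conv_lhs => rw [this]
      simp
    rw [eisSummand_of_gammaSet_eq_divIntMap, e, hφ, _root_.zpow_natCast]
    ring
  rw [tsum_congr hv, tsum_mul_left]
  rcases eq_or_ne b 0 with rfl | hb
  · simp [hw]
  · have : NeZero b := ⟨hb⟩
    congr 1
    exact (gammaSetDivGcdEquiv b).tsum_eq fun v : gammaSet 1 1 0 =>
      φ (fun i => ((v : Fin 2 → ℤ) i : ZMod N)) * eisSummand w v z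

/-- If `φ` is homogeneous with character `χ`, the sum over all pairs is the sum over the coprime
pairs multiplied by the value at `w` of the `L`-series of `χ`. -/
lemma tsum_mul_eisSummand_eq {w : ℕ} (hw : 3 ≤ w) {φ : (Fin 2 → ZMod N) → ℂ}
    {χ : DirichletCharacter ℂ N} (hφ : ∀ (g : ZMod N) a, φ (g • a) = χ g * φ a) (z : ℍ) :
    ∑' v : Fin 2 → ℤ, φ (fun i => (v i : ZMod N)) * eisSummand w v z =
      (∑' n : ℕ, χ (n : ZMod N) * ((n : ℂ) ^ w)⁻¹) * eisSum w φ z := by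
  have hw' : (3 : ℤ) ≤ w := by exact_mod_cast hw
  have hnorm := summable_norm_mul_eisSummand hw φ z
  rw [eisSum_eq_tsum hw', ← gammaSetDivGcdSigmaEquiv.symm.tsum_eq, ← tsum_mul_right]
  have hsig := gammaSetDivGcdSigmaEquiv.symm.summable_iff.mpr hnorm.of_norm
  refine (Summable.tsum_sigma hsig).trans (tsum_congr fun b => ?_)
  exact tsum_gammaSet_mul_eisSummand (by omega) hφ z b

end eisSum

/-! ### The value of the `L`-series of `χ₋₄` at an odd positive integer -/

lemma chiNegFour_natCast (n : ℕ) : chiNegFour (n : ZMod 4) =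
    if n % 2 = 0 then 0 else if n % 4 = 1 then 1 else -1 := by
  rw [chiNegFour, MulChar.ringHomComp_apply, ZMod.χ₄_nat_eq_if_mod_four]
  split_ifs <;> simp

lemma chiNegFour_zero : chiNegFour 0 = 0 := by
  simpa using chiNegFour_natCast 0

lemma chiNegFour_neg (a : ZMod 4) : chiNegFour (-a) = -chiNegFour a := by
  rw [chiNegFour, MulChar.ringHomComp_apply, MulChar.ringHomComp_apply, ← map_neg]
  congr 1
  revert a
  decide

/-- The generating function of the Bernoulli polynomials in the variable `4 x`. -/
lemma rescale_exp_mul_inv (t : ℂ) :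
    PowerSeries.rescale (4 * t) (PowerSeries.exp ℂ) *
        (PowerSeries.mk fun m : ℕ => (4 : ℂ) ^ (m + 1) / ((m + 1).factorial : ℂ))⁻¹ =
      PowerSeries.C (4⁻¹ : ℂ) * PowerSeries.rescale 4 (PowerSeries.mk fun n : ℕ =>
        Polynomial.aeval t ((1 / (n.factorial : ℚ)) • Polynomial.bernoulli n)) := by
  set D : PowerSeries ℂ := PowerSeries.mk fun m : ℕ => (4 : ℂ) ^ (m + 1) / ((m + 1).factorial : ℂ)
    with hD
  have hD0 : PowerSeries.constantCoeff D ≠ 0 := by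
    rw [hD, ← PowerSeries.coeff_zero_eq_constantCoeff_apply, PowerSeries.coeff_mk]
    norm_num
  have hXD : PowerSeries.rescale (4 : ℂ) (PowerSeries.exp ℂ - 1) = PowerSeries.X * D := by
    ext n
    rcases n with _ | n
    · rw [PowerSeries.coeff_rescale, map_sub, PowerSeries.coeff_exp, PowerSeries.coeff_one]
      simp
    · rw [PowerSeries.coeff_succ_X_mul, hD, PowerSeries.coeff_mk, PowerSeries.coeff_rescale,
        map_sub, PowerSeries.coeff_exp, PowerSeries.coeff_one]
      simp [div_eq_mul_inv]
  have hg := congrArg (PowerSeries.rescale (4 : ℂ)) (Polynomial.bernoulli_generating_function t)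
  rw [map_mul, hXD, map_mul, PowerSeries.rescale_X, PowerSeries.rescale_rescale] at hg
  rw [eq_comm, PowerSeries.eq_mul_inv_iff_mul_eq hD0]
  have h4 : PowerSeries.C (4⁻¹ : ℂ) * PowerSeries.C (4 : ℂ) = 1 := by
    rw [← map_mul, inv_mul_cancel₀ (by norm_num), map_one]
  refine mul_left_cancel₀ PowerSeries.X_ne_zero ?_
  rw [mul_comm (4 : ℂ) t]
  linear_combination PowerSeries.C (4⁻¹ : ℂ) * hg +
    PowerSeries.X * PowerSeries.rescale (t * 4) (PowerSeries.exp ℂ) * h4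

lemma generalizedBernoulli_chiNegFour {w : ℕ} (hodd : Odd w) :
    generalizedBernoulli chiNegFour w =
      2 * 4 ^ w / 4 * (((Polynomial.bernoulli w).eval (1 / 4 : ℚ) : ℚ) : ℂ) := by
  have hval (x : ℚ) : Polynomial.aeval (x : ℂ) (Polynomial.bernoulli w) =
      (((Polynomial.bernoulli w).eval x : ℚ) : ℂ) :=
    Polynomial.aeval_algebraMap_apply_eq_algebraMap_eval x _
  have h3 : (Polynomial.bernoulli w).eval (3 / 4 : ℚ) =
      -(Polynomial.bernoulli w).eval (1 / 4 : ℚ) := by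
    rw [show (3 / 4 : ℚ) = 1 - 1 / 4 by norm_num, Polynomial.bernoulli_eval_one_sub,
      hodd.neg_one_pow, neg_one_mul]
  have hs : ∑ a ∈ Finset.Icc (1 : ℕ) 4, PowerSeries.C (chiNegFour (a : ZMod 4)) *
      PowerSeries.rescale (a : ℂ) (PowerSeries.exp ℂ) =
      PowerSeries.rescale (4 * ((1 / 4 : ℚ) : ℂ)) (PowerSeries.exp ℂ) -
        PowerSeries.rescale (4 * ((3 / 4 : ℚ) : ℂ)) (PowerSeries.exp ℂ) := by
    rw [show Finset.Icc (1 : ℕ) 4 = {1, 2, 3, 4} by rfl]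
    rw [Finset.sum_insert (by simp), Finset.sum_insert (by simp), Finset.sum_insert (by simp),
      Finset.sum_singleton]
    simp only [chiNegFour_natCast]
    norm_num
    ring
  have hfac : (w.factorial : ℂ) ≠ 0 := by exact_mod_cast w.factorial_ne_zero
  rw [generalizedBernoulli]
  push_cast
  rw [hs]
  rw [sub_mul, rescale_exp_mul_inv, rescale_exp_mul_inv, map_sub]
  simp only [PowerSeries.coeff_C_mul, PowerSeries.coeff_rescale, PowerSeries.coeff_mk, map_smul]
  rw [hval, hval, h3]
  simp only [Rat.smul_def]
  push_cast
  field_simp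
  ring

/-- The value at `w` of the `L`-series of `χ₋₄`. The term `n = 0` vanishes because `χ₋₄(0) = 0`. -/
def lValue (w : ℕ) : ℂ := ∑' n : ℕ, chiNegFour (n : ZMod 4) * ((n : ℂ) ^ w)⁻¹

lemma lValue_ne_zero {w : ℕ} (hw : 1 < w) : lValue w ≠ 0 := by
  have h := DirichletCharacter.LSeries_ne_zero_of_one_lt_re chiNegFour (s := (w : ℂ))
    (by simpa using hw)
  convert h using 1
  refine tsum_congr fun n => ?_
  rcases eq_or_ne n 0 with rfl | hn
  · simp [show w ≠ 0 by omega]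
  · rw [LSeries.term_of_ne_zero hn, Complex.cpow_natCast, div_eq_mul_inv]

lemma sin_two_pi_mul_quarter (n : ℕ) : (Real.sin (2 * Real.pi * n * (1 / 4)) : ℂ) =
    chiNegFour (n : ZMod 4) := by
  rw [chiNegFour_natCast, ← Nat.div_add_mod n 4]
  have h4 := Nat.mod_lt n (by norm_num : 0 < 4)
  generalize n / 4 = m at *
  generalize n % 4 = r at *
  have e : 2 * Real.pi * ((4 * m + r : ℕ) : ℝ) * (1 / 4) = r * Real.pi / 2 + m * (2 * Real.pi) := by
    push_cast
    ring
  rw [e, Real.sin_add_nat_mul_two_pi]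
  interval_cases r
  · simp [show (4 * m) % 2 = 0 by omega]
  · simp [show (4 * m + 1) % 2 = 1 by omega, show (4 * m + 1) % 4 = 1 by omega]
  · simp [show (4 * m + 2) % 2 = 0 by omega]
  · have : ((3 : ℕ) : ℝ) * Real.pi / 2 = Real.pi / 2 + Real.pi := by push_cast; ring
    rw [this, Real.sin_add_pi]
    simp [show (4 * m + 3) % 2 = 1 by omega, show (4 * m + 3) % 4 = 3 by omega]

/-- The classical evaluation of the `L`-series by generalized Bernoulli numbers: the Fourier series
of the Bernoulli polynomial at `1 / 4`, where `sin (2 π n / 4) = χ₋₄(n)`. -/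
lemma factorial_mul_lValue {w : ℕ} (hw : 1 < w) (hodd : Odd w) :
    (w.factorial : ℂ) * lValue w * 4 ^ w =
      -Complex.I * generalizedBernoulli chiNegFour w * (-2 * Real.pi * Complex.I) ^ w := by
  obtain ⟨k, rfl⟩ := hodd
  have h := hasSum_one_div_nat_pow_mul_sin (k := k) (x := 1 / 4) (by omega)
    ⟨by norm_num, by norm_num⟩
  have h' := (Complex.hasSum_ofReal.2 h).tsum_eq
  have hL : ∑' n : ℕ, ((1 / (n : ℝ) ^ (2 * k + 1) * Real.sin (2 * Real.pi * n * (1 / 4)) : ℝ) : ℂ) =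
      lValue (2 * k + 1) := by
    refine tsum_congr fun n => ?_
    rw [Complex.ofReal_mul, sin_two_pi_mul_quarter]
    push_cast
    ring
  have hB : (Polynomial.map (algebraMap ℚ ℝ) (Polynomial.bernoulli (2 * k + 1))).eval (1 / 4) =
      (((Polynomial.bernoulli (2 * k + 1)).eval (1 / 4 : ℚ) : ℚ) : ℝ) := by
    rw [show (1 / 4 : ℝ) = algebraMap ℚ ℝ (1 / 4 : ℚ) by simp, Polynomial.eval_map,
      Polynomial.eval₂_at_apply]
    rfl
  have hfac : (((2 * k + 1).factorial : ℕ) : ℂ) ≠ 0 := by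
    exact_mod_cast (2 * k + 1).factorial_ne_zero
  rw [hL, hB] at h'
  rw [h', generalizedBernoulli_chiNegFour ⟨k, rfl⟩]
  have hI : (-2 * Real.pi * Complex.I) ^ (2 * k + 1) =
      -((2 * Real.pi : ℂ) ^ (2 * k + 1) * ((-1) ^ k * Complex.I)) := by
    rw [show (-2 * Real.pi * Complex.I : ℂ) = -(2 * Real.pi * Complex.I) by ring,
      Odd.neg_pow ⟨k, rfl⟩, mul_pow _ Complex.I, pow_succ Complex.I, pow_mul, Complex.I_sq]
  rw [hI]
  push_cast
  field_simp
  linear_combination (-4) * (-1) ^ k *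
    (((Polynomial.bernoulli (2 * k + 1)).eval (1 / 4 : ℚ) : ℚ) : ℂ) *
    Complex.I_sq

lemma generalizedBernoulli_ne_zero {w : ℕ} (hw : 1 < w) (hodd : Odd w) :
    generalizedBernoulli chiNegFour w ≠ 0 := by
  intro h
  have h' := factorial_mul_lValue hw hodd
  rw [h, mul_zero, zero_mul] at h'
  have hfac : (w.factorial : ℂ) ≠ 0 := by exact_mod_cast w.factorial_ne_zero
  exact mul_ne_zero (mul_ne_zero hfac (lValue_ne_zero hw)) (pow_ne_zero _ (by norm_num)) h'

/-! ### Fourier expansions of the Eisenstein series of odd weight -/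

/-- The constant `(-2πi)^w / (w - 1)!` of the Lipschitz formula. -/
def lipschitzConst (w : ℕ) : ℂ := (-2 * Real.pi * Complex.I) ^ w / ((w - 1).factorial : ℂ)

lemma tsum_add_int_zpow {w : ℕ} (hw : 2 ≤ w) {z : ℂ} (hz : 0 < z.im) :
    ∑' n : ℤ, (z + n) ^ (-(w : ℤ)) =
      lipschitzConst w * ∑' n : ℕ+, (n : ℂ) ^ (w - 1) * nome z ^ (n : ℕ) := by
  have h := qExpansion_identity_pnat (k := w - 1) (by omega) ⟨z, hz⟩
  rw [show w - 1 + 1 = w by omega] at h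
  refine Eq.trans (tsum_congr fun n => ?_) h
  rw [_root_.zpow_neg, _root_.zpow_natCast, one_div]

lemma summable_add_int_zpow {w : ℕ} (hw : 2 ≤ w) (z : ℂ) :
    Summable fun n : ℤ => (z + n) ^ (-(w : ℤ)) := by
  have h := linear_right_summable z 1 (k := w) (by exact_mod_cast hw)
  refine h.congr fun n => ?_
  rw [_root_.zpow_neg, Int.cast_one, one_mul]

lemma norm_nome_lt_one {z : ℂ} (hz : 0 < z.im) : ‖nome z‖ < 1 :=
  norm_exp_two_pi_I_lt_one ⟨z, hz⟩

lemma nome_natCast_mul (n : ℕ) (z : ℂ) : nome (n * z) = nome z ^ n := by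
  rw [nome, nome, ← Complex.exp_nat_mul]
  congr 1
  ring

lemma norm_chiNegFour_le (a : ZMod 4) : ‖chiNegFour a‖ ≤ 1 := chiNegFour.norm_le_one a

/-- The Lambert series of a twisted divisor sum. -/
lemma tsum_prod_eq_tsum_twistedSigma {M N : ℕ} (ψ : DirichletCharacter ℂ M)
    (χ : DirichletCharacter ℂ N) (k : ℕ) {r : ℂ} (hr : ‖r‖ < 1) :
    ∑' d : ℕ+, ∑' c : ℕ+, χ (d : ℕ) * (ψ (c : ℕ) * (c : ℂ) ^ k * r ^ (d * c : ℕ)) =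
      ∑' n : ℕ+, twistedSigma k ψ χ n * r ^ (n : ℕ) := by
  have hs : Summable fun c : ℕ+ × ℕ+ =>
      χ (c.1 : ℕ) * (ψ (c.2 : ℕ) * (c.2 : ℂ) ^ k * r ^ (c.1 * c.2 : ℕ)) := by
    refine (summable_prod_mul_pow k hr).norm.of_norm_bounded fun c => ?_
    rw [norm_mul, mul_assoc, norm_mul (ψ _)]
    exact (mul_le_of_le_one_left (by positivity) (χ.norm_le_one _)).trans
      (mul_le_of_le_one_left (by positivity) (ψ.norm_le_one _))
  rw [← Summable.tsum_prod hs, ← sigmaAntidiagonalEquivProd.tsum_eq]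
  refine (Summable.tsum_sigma (sigmaAntidiagonalEquivProd.summable_iff.2 hs)).trans
    (tsum_congr fun n => ?_)
  rw [tsum_fintype, twistedSigma, Finset.sum_mul]
  have h1 := (n : ℕ).divisorsAntidiagonal.sum_attach fun x : ℕ × ℕ =>
    χ (x.1 : ℕ) * (ψ (x.2 : ℕ) * (x.2 : ℂ) ^ k * r ^ (x.1 * x.2))
  refine Eq.trans h1 ?_
  rw [← Nat.map_swap_divisorsAntidiagonal, Finset.sum_map]
  refine (Nat.sum_divisorsAntidiagonal fun x y : ℕ =>
    χ (y : ℕ) * (ψ (x : ℕ) * (x : ℂ) ^ k * r ^ (y * x))).trans ?_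
  refine Finset.sum_congr rfl fun d hd => ?_
  rw [Nat.div_mul_cancel (Nat.dvd_of_mem_divisors hd)]
  ring

lemma summable_prod_mul_eisSummand {w : ℕ} (hw : 3 ≤ w) (φ : (Fin 2 → ZMod 4) → ℂ) (z : ℍ) :
    Summable fun x : ℤ × ℤ => φ ![(x.1 : ZMod 4), x.2] * eisSummand w ![x.1, x.2] z := by
  refine (finTwoArrowEquiv ℤ).summable_iff.mp <|
    (summable_norm_mul_eisSummand hw φ z).of_norm.congr fun v => ?_
  have e1 : (finTwoArrowEquiv ℤ v) = (v 0, v 1) := rfl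
  have e2 : ![v 0, v 1] = v := by ext i; fin_cases i <;> rfl
  have e3 : (fun i => (v i : ZMod 4)) = ![(v 0 : ZMod 4), v 1] := by ext i; fin_cases i <;> rfl
  simp only [Function.comp_apply, e1, e2, e3]

lemma tsum_mul_eisSummand_eq_tsum_tsum {w : ℕ} (hw : 3 ≤ w) (φ : (Fin 2 → ZMod 4) → ℂ) (z : ℍ) :
    ∑' v : Fin 2 → ℤ, φ (fun i => (v i : ZMod 4)) * eisSummand w v z =
      ∑' m : ℤ, ∑' n : ℤ, φ ![(m : ZMod 4), n] * ((m : ℂ) * z + n) ^ (-(w : ℤ)) := by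
  rw [← (finTwoArrowEquiv ℤ).symm.tsum_eq]
  refine Eq.trans (tsum_congr fun x => ?_)
    (Summable.tsum_prod (summable_prod_mul_eisSummand hw φ z))
  have e3 : (fun i => ((finTwoArrowEquiv ℤ).symm x i : ZMod 4)) = ![(x.1 : ZMod 4), x.2] := by
    ext i; fin_cases i <;> rfl
  rw [e3]
  rfl

lemma summable_tsum_mul_add_zpow {w : ℕ} (hw : 3 ≤ w) (φ : (Fin 2 → ZMod 4) → ℂ) (z : ℍ) :
    Summable fun m : ℤ => ∑' n : ℤ, φ ![(m : ZMod 4), n] * ((m : ℂ) * z + n) ^ (-(w : ℤ)) :=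
  (summable_prod_mul_eisSummand hw φ z).prod

/-- The function `(m, n) ↦ χ₋₄(m)`. -/
def phiOne (a : Fin 2 → ZMod 4) : ℂ := chiNegFour (a 0)

/-- The function `(m, n) ↦ χ₋₄(n)` supported on `m ≡ 0` modulo `4`. -/
def phiTwo (a : Fin 2 → ZMod 4) : ℂ := if a 0 = 0 then chiNegFour (a 1) else 0

lemma phiOne_smul (g : ZMod 4) (a : Fin 2 → ZMod 4) :
    phiOne (g • a) = chiNegFour g * phiOne a := by
  simp [phiOne]

lemma phiTwo_smul (g : ZMod 4) (a : Fin 2 → ZMod 4) :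
    phiTwo (g • a) = chiNegFour g * phiTwo a := by
  by_cases hg : IsUnit g
  · simp [phiTwo, hg.mul_right_eq_zero]
  · simp [phiTwo, chiNegFour.map_nonunit hg]

/-- Reversing the signs of both entries shows that the sum over a row depends only on `|m|`, when
the weight and `φ` are odd. -/
lemma even_tsum_mul_add_zpow {w : ℕ} (hodd : Odd w) {φ : (Fin 2 → ZMod 4) → ℂ}
    (hφ : ∀ g a, φ (g • a) = chiNegFour g * φ a) (z : ℂ) :
    Function.Even fun m : ℤ =>
      ∑' n : ℤ, φ ![(m : ZMod 4), n] * ((m : ℂ) * z + n) ^ (-(w : ℤ)) := by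
  intro m
  dsimp only
  rw [← (Equiv.neg ℤ).tsum_eq]
  refine tsum_congr fun n => ?_
  have e : ![((-m : ℤ) : ZMod 4), ((Equiv.neg ℤ n : ℤ) : ZMod 4)] =
      (-1 : ZMod 4) • ![(m : ZMod 4), n] := by
    ext i; fin_cases i <;> simp
  have hχ : chiNegFour (-1) = -1 := by rw [chiNegFour_neg, map_one]
  have e2 : (((-m : ℤ) : ℂ) * z + ((Equiv.neg ℤ n : ℤ) : ℂ)) = -((m : ℂ) * z + n) := by
    rw [Equiv.neg_apply]
    push_cast
    ring
  rw [e, hφ, hχ, e2, _root_.zpow_neg, _root_.zpow_neg, _root_.zpow_natCast, _root_.zpow_natCast,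
    hodd.neg_pow, inv_neg]
  ring

/-- The sum of all terms `χ₋₄(m) (m z + n)^{-w}`. -/
lemma tsum_phiOne_mul_eisSummand {w : ℕ} (hw : 3 ≤ w) (hodd : Odd w) (z : ℍ) :
    ∑' v : Fin 2 → ℤ, phiOne (fun i => (v i : ZMod 4)) * eisSummand w v z =
      2 * lipschitzConst w * ∑' n : ℕ+,
        twistedSigma (w - 1) (1 : DirichletCharacter ℂ 1) chiNegFour n * nome z ^ (n : ℕ) := by
  rw [tsum_mul_eisSummand_eq_tsum_tsum hw, tsum_int_eq_zero_add_two_mul_tsum_pnat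
    (even_tsum_mul_add_zpow hodd phiOne_smul z) (summable_tsum_mul_add_zpow hw phiOne z),
    ← tsum_prod_eq_tsum_twistedSigma _ _ _ (norm_nome_lt_one z.2), nsmul_eq_mul, mul_assoc,
    ← tsum_mul_left (a := lipschitzConst w)]
  have h0 : ∑' n : ℤ, phiOne ![((0 : ℤ) : ZMod 4), n] *
      (((0 : ℤ) : ℂ) * z + n) ^ (-(w : ℤ)) = 0 := by
    simp [phiOne, chiNegFour_zero]
  rw [h0, zero_add]
  congr 1
  refine tsum_congr fun m => ?_
  have hm : 0 < ((m : ℂ) * z).im := by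
    have := z.2
    simpa using this
  have h1 (n : ℤ) : phiOne ![((m : ℤ) : ZMod 4), n] * (((m : ℤ) : ℂ) * z + n) ^ (-(w : ℤ)) =
      chiNegFour (m : ℕ) * ((m : ℂ) * z + n) ^ (-(w : ℤ)) := by
    simp [phiOne]
  rw [tsum_congr h1, tsum_mul_left, tsum_add_int_zpow (by omega) hm, tsum_mul_left, mul_left_comm]
  congr 2
  refine tsum_congr fun n => ?_
  rw [nome_natCast_mul, ← pow_mul, MulChar.one_apply (isUnit_of_subsingleton _), one_mul]

lemma summable_mul_add_int_zpow {w : ℕ} (hw : 2 ≤ w) (z : ℂ) :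
    Summable fun n : ℤ => chiNegFour (n : ZMod 4) * (z + n) ^ (-(w : ℤ)) := by
  refine (summable_add_int_zpow hw z).norm.of_norm_bounded fun n => ?_
  rw [norm_mul]
  exact mul_le_of_le_one_left (norm_nonneg _) (norm_chiNegFour_le _)

lemma summable_pow_mul_nome (k : ℕ) {z : ℂ} (hz : 0 < z.im) :
    Summable fun n : ℕ+ => (n : ℂ) ^ k * nome z ^ (n : ℕ) := by
  have h := summable_pow_mul_cexp k 1 ⟨z, hz⟩
  simp only [PNat.one_coe, Nat.cast_one, mul_one] at h
  exact h.comp_injective PNat.coe_injective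

lemma nome_add_div_four_pow (z : ℂ) (a n : ℕ) :
    nome ((z + a) / 4) ^ n = Complex.I ^ (a * n) * nome (z / 4) ^ n := by
  have : nome ((z + a) / 4) = Complex.I ^ a * nome (z / 4) := by
    have hI : Complex.I ^ a = Complex.exp (a * (Real.pi / 2 * Complex.I)) := by
      rw [Complex.exp_nat_mul, Complex.exp_pi_div_two_mul_I]
    rw [nome, nome, hI, ← Complex.exp_add]
    congr 1
    ring
  rw [this, mul_pow, pow_mul]

lemma I_pow_sub_I_pow (n : ℕ) :
    Complex.I ^ (1 * n) - Complex.I ^ (3 * n) = 2 * Complex.I * chiNegFour (n : ZMod 4) := by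
  rw [chiNegFour_natCast, one_mul, pow_mul, Complex.I_pow_three]
  rw [← Nat.div_add_mod n 4]
  have h4 := Nat.mod_lt n (by norm_num : 0 < 4)
  generalize n / 4 = m at *
  generalize n % 4 = r at *
  rw [pow_add, pow_mul, Complex.I_pow_four, one_pow, one_mul, pow_add (-Complex.I), pow_mul,
    show (-Complex.I) ^ 4 = 1 by rw [Even.neg_pow (by decide), Complex.I_pow_four], one_pow,
    one_mul]
  interval_cases r
  · simp [show (4 * m) % 2 = 0 by omega]
  · simp [show (4 * m + 1) % 2 = 1 by omega, show (4 * m + 1) % 4 = 1 by omega]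
    ring
  · simp [show (4 * m + 2) % 2 = 0 by omega]
  · simp [show (4 * m + 3) % 2 = 1 by omega, show (4 * m + 3) % 4 = 3 by omega, pow_succ]
    ring

/-- The Lipschitz formula twisted by `χ₋₄`, from the formula at the points `(z + a) / 4`. -/
lemma tsum_chiNegFour_mul_add_int_zpow {w : ℕ} (hw : 2 ≤ w) {z : ℂ} (hz : 0 < z.im) :
    ∑' n : ℤ, chiNegFour (n : ZMod 4) * (z + n) ^ (-(w : ℤ)) =
      2 * Complex.I * lipschitzConst w / 4 ^ w *
        ∑' n : ℕ+, chiNegFour (n : ℕ) * (n : ℂ) ^ (w - 1) * nome (z / 4) ^ (n : ℕ) := by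
  have hs := (Int.divModEquiv 4).symm.summable_iff.2 (summable_mul_add_int_zpow hw z)
  have hza (a : ℕ) : 0 < ((z + a) / 4).im := by
    have : ((z + a) / 4).im = z.im / 4 := by simp
    rw [this]
    positivity
  have hterm (a : Fin 4) (n : ℤ) : chiNegFour (((Int.divModEquiv 4).symm (n, a) : ℤ) : ZMod 4) *
      (z + (((Int.divModEquiv 4).symm (n, a) : ℤ) : ℂ)) ^ (-(w : ℤ)) =
      chiNegFour (((a : ℕ) : ZMod 4)) / 4 ^ w * ((z + (a : ℕ)) / 4 + n) ^ (-(w : ℤ)) := by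
    have e1 : (((Int.divModEquiv 4).symm (n, a) : ℤ) : ZMod 4) = ((a : ℕ) : ZMod 4) := by
      have : ((Int.divModEquiv 4).symm (n, a) : ℤ) = n * (4 : ℕ) + ((a : ℕ) : ℤ) := rfl
      rw [this]
      have h4 : (4 : ZMod 4) = 0 := rfl
      push_cast
      rw [h4, mul_zero, zero_add]
    have e2 : z + (((Int.divModEquiv 4).symm (n, a) : ℤ) : ℂ) =
        4 * ((z + (a : ℕ)) / 4 + n) := by
      have : ((Int.divModEquiv 4).symm (n, a) : ℤ) = n * (4 : ℕ) + ((a : ℕ) : ℤ) := rfl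
      rw [this]
      push_cast
      ring
    rw [e1, e2, mul_zpow, _root_.zpow_neg 4, _root_.zpow_natCast]
    ring
  rw [← (Int.divModEquiv 4).symm.tsum_eq]
  -- Summation over the residue `a` modulo `4` last.
  have hcomm := Summable.tsum_comm (f := fun (a : Fin 4) (n : ℤ) =>
    chiNegFour (((Int.divModEquiv 4).symm (n, a) : ℤ) : ZMod 4) *
      (z + (((Int.divModEquiv 4).symm (n, a) : ℤ) : ℂ)) ^ (-(w : ℤ))) hs.prod_symm
  refine (Summable.tsum_prod hs).trans (hcomm.trans ?_)
  rw [tsum_fintype, Finset.sum_congr rfl fun a _ => (tsum_congr (hterm a)).trans tsum_mul_left]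
  simp only [fun a => tsum_add_int_zpow hw (hza a)]
  rw [Fin.sum_univ_four]
  have c0 : chiNegFour (((0 : Fin 4) : ℕ) : ZMod 4) = 0 := by rw [chiNegFour_natCast]; rfl
  have c1 : chiNegFour (((1 : Fin 4) : ℕ) : ZMod 4) = 1 := by rw [chiNegFour_natCast]; rfl
  have c2 : chiNegFour (((2 : Fin 4) : ℕ) : ZMod 4) = 0 := by rw [chiNegFour_natCast]; rfl
  have c3 : chiNegFour (((3 : Fin 4) : ℕ) : ZMod 4) = -1 := by rw [chiNegFour_natCast]; rfl
  rw [c0, c1, c2, c3]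
  have hsub := (summable_pow_mul_nome (w - 1) (hza 1)).tsum_sub
    (summable_pow_mul_nome (w - 1) (hza 3))
  have hval : ∑' n : ℕ+, ((n : ℂ) ^ (w - 1) * nome ((z + (1 : ℕ)) / 4) ^ (n : ℕ) -
      (n : ℂ) ^ (w - 1) * nome ((z + (3 : ℕ)) / 4) ^ (n : ℕ)) =
      2 * Complex.I *
        ∑' n : ℕ+, chiNegFour (n : ℕ) * (n : ℂ) ^ (w - 1) * nome (z / 4) ^ (n : ℕ) := by
    rw [← tsum_mul_left]
    refine tsum_congr fun n => ?_
    rw [nome_add_div_four_pow, nome_add_div_four_pow]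
    linear_combination ((n : ℂ) ^ (w - 1) * nome (z / 4) ^ (n : ℕ)) * I_pow_sub_I_pow n
  rw [hval] at hsub
  change 0 / 4 ^ w * _ + 1 / 4 ^ w * (lipschitzConst w *
    ∑' n : ℕ+, (n : ℂ) ^ (w - 1) * nome ((z + (1 : ℕ)) / 4) ^ (n : ℕ)) + 0 / 4 ^ w * _ +
    -1 / 4 ^ w * (lipschitzConst w *
    ∑' n : ℕ+, (n : ℂ) ^ (w - 1) * nome ((z + (3 : ℕ)) / 4) ^ (n : ℕ)) = _
  linear_combination (-lipschitzConst w / 4 ^ w) * hsub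

lemma tsum_int_eq_tsum_four_mul {f : ℤ → ℂ} (hf : ∀ m : ℤ, (m : ZMod 4) ≠ 0 → f m = 0) :
    ∑' m : ℤ, f m = ∑' m : ℤ, f (4 * m) := by
  have hinj : Function.Injective fun m : ℤ => 4 * m := fun a b h => by
    have : 4 * a = 4 * b := h
    omega
  refine (hinj.tsum_eq fun m hm => ?_).symm
  by_contra h
  refine hm (hf m fun h0 => h ?_)
  obtain ⟨n, rfl⟩ := (ZMod.intCast_zmod_eq_zero_iff_dvd m 4).1 h0
  exact ⟨n, rfl⟩

lemma tsum_chiNegFour_mul_int_zpow {w : ℕ} (hw : 2 ≤ w) (hodd : Odd w) :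
    ∑' n : ℤ, chiNegFour (n : ZMod 4) * (n : ℂ) ^ (-(w : ℤ)) = 2 * lValue w := by
  have heven : Function.Even fun n : ℤ => chiNegFour (n : ZMod 4) * (n : ℂ) ^ (-(w : ℤ)) := by
    intro n
    simp only [Int.cast_neg, chiNegFour_neg, _root_.zpow_neg, _root_.zpow_natCast, hodd.neg_pow]
    rw [inv_neg, neg_mul_neg]
  have hs := summable_mul_add_int_zpow hw 0
  simp only [zero_add] at hs
  rw [tsum_int_eq_zero_add_two_mul_tsum_pnat heven hs, lValue,
    ← tsum_zero_pnat_eq_tsum_nat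
      (summable_norm_character_mul_inv_pow (by omega) chiNegFour).of_norm]
  simp [chiNegFour_zero]

/-- The sum of all terms `χ₋₄(n) (m z + n)^{-w}` with `4 ∣ m`. -/
lemma tsum_phiTwo_mul_eisSummand {w : ℕ} (hw : 3 ≤ w) (hodd : Odd w) (z : ℍ) :
    ∑' v : Fin 2 → ℤ, phiTwo (fun i => (v i : ZMod 4)) * eisSummand w v z =
      2 * lValue w + 4 * Complex.I * lipschitzConst w / 4 ^ w * ∑' n : ℕ+,
        twistedSigma (w - 1) chiNegFour (1 : DirichletCharacter ℂ 1) n * nome z ^ (n : ℕ) := by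
  have heven := even_tsum_mul_add_zpow hodd phiTwo_smul z
  have hsum := summable_tsum_mul_add_zpow hw phiTwo z
  have hinj : Function.Injective fun m : ℤ => 4 * m := fun a b h => by
    have : 4 * a = 4 * b := h
    omega
  have hrow (m : ℤ) (hm : (m : ZMod 4) ≠ 0) :
      ∑' n : ℤ, phiTwo ![(m : ZMod 4), n] * ((m : ℂ) * z + n) ^ (-(w : ℤ)) = 0 := by
    simp [phiTwo, hm]
  have hrow4 (m : ℤ) :
      ∑' n : ℤ, phiTwo ![((4 * m : ℤ) : ZMod 4), n] * (((4 * m : ℤ) : ℂ) * z + n) ^ (-(w : ℤ)) =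
        ∑' n : ℤ, chiNegFour (n : ZMod 4) * (4 * (m * (z : ℂ)) + n) ^ (-(w : ℤ)) := by
    have h4 : ((4 * m : ℤ) : ZMod 4) = 0 := by
      rw [Int.cast_mul, show ((4 : ℤ) : ZMod 4) = 0 from rfl, zero_mul]
    refine tsum_congr fun n => ?_
    simp only [h4, phiTwo]
    simp [mul_assoc]
  have heven4 : Function.Even fun m : ℤ =>
      ∑' n : ℤ, chiNegFour (n : ZMod 4) * (4 * (m * (z : ℂ)) + n) ^ (-(w : ℤ)) := fun m => by
    dsimp only
    rw [← hrow4, ← hrow4, mul_neg]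
    exact heven (4 * m)
  have hsum4 : Summable fun m : ℤ =>
      ∑' n : ℤ, chiNegFour (n : ZMod 4) * (4 * (m * (z : ℂ)) + n) ^ (-(w : ℤ)) :=
    (hsum.comp_injective hinj).congr hrow4
  rw [tsum_mul_eisSummand_eq_tsum_tsum hw, tsum_int_eq_tsum_four_mul hrow, tsum_congr hrow4,
    tsum_int_eq_zero_add_two_mul_tsum_pnat heven4 hsum4,
    ← tsum_prod_eq_tsum_twistedSigma _ _ _ (norm_nome_lt_one z.2), nsmul_eq_mul]
  congr 1
  · rw [← tsum_chiNegFour_mul_int_zpow (by omega) hodd]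
    simp
  · have hm (m : ℕ+) : ∑' n : ℤ, chiNegFour (n : ZMod 4) *
        (4 * (((m : ℤ) : ℂ) * (z : ℂ)) + n) ^ (-(w : ℤ)) =
        2 * Complex.I * lipschitzConst w / 4 ^ w * ∑' n : ℕ+, (1 : DirichletCharacter ℂ 1) (m : ℕ) *
          (chiNegFour (n : ℕ) * (n : ℂ) ^ (w - 1) * nome z ^ (m * n : ℕ)) := by
      have him : 0 < (4 * (((m : ℤ) : ℂ) * (z : ℂ))).im := by
        have := z.2
        simpa using this
      rw [tsum_chiNegFour_mul_add_int_zpow (by omega) him]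
      congr 1
      refine tsum_congr fun n => ?_
      rw [mul_div_cancel_left₀ _ (by norm_num), Int.cast_natCast, nome_natCast_mul, ← pow_mul,
        MulChar.one_apply (isUnit_of_subsingleton _), one_mul]
    rw [tsum_congr hm, tsum_mul_left]
    push_cast
    ring

lemma lipschitzConst_div_lValue {w : ℕ} (hw : 1 < w) (hodd : Odd w) :
    lipschitzConst w / (4 ^ w * lValue w) =
      w * Complex.I / generalizedBernoulli chiNegFour w := by
  have hB := generalizedBernoulli_ne_zero hw hodd
  have hL := lValue_ne_zero hw
  have hfac : ((w - 1).factorial : ℂ) ≠ 0 := by exact_mod_cast (w - 1).factorial_ne_zero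
  have h := factorial_mul_lValue hw hodd
  rw [← Nat.mul_factorial_pred (by omega), Nat.cast_mul] at h
  rw [lipschitzConst, div_div, div_eq_div_iff
    (mul_ne_zero hfac (mul_ne_zero (pow_ne_zero _ (by norm_num)) hL)) hB]
  linear_combination (-Complex.I) * h + generalizedBernoulli chiNegFour w *
    (-2 * Real.pi * Complex.I) ^ w * Complex.I_sq

lemma eisensteinE1_eq_eisSum {w : ℕ} (hw : 3 ≤ w) (hodd : Odd w) (z : ℍ) :
    eisensteinE1 w z = Complex.I / 4 ^ w * eisSum w phiOne z := by
  have hL := lValue_ne_zero (w := w) (by omega)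
  have h1 := tsum_phiOne_mul_eisSummand hw hodd z
  rw [tsum_mul_eisSummand_eq hw phiOne_smul] at h1
  change lValue w * _ = _ at h1
  have hc := lipschitzConst_div_lValue (w := w) (by omega) hodd
  have h4 : (4 : ℂ) ^ w ≠ 0 := pow_ne_zero _ (by norm_num)
  rw [eisensteinE1, eq_div_of_mul_eq hL ((mul_comm _ _).trans h1)]
  generalize (∑' n : ℕ+, twistedSigma (w - 1) (1 : DirichletCharacter ℂ 1) chiNegFour n *
    nome z ^ (n : ℕ)) = S
  have e : Complex.I / 4 ^ w * (2 * lipschitzConst w * S / lValue w) =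
      2 * Complex.I * S * (lipschitzConst w / (4 ^ w * lValue w)) := by
    field_simp
  rw [e, hc]
  linear_combination (-2 * S * w / generalizedBernoulli chiNegFour w) * Complex.I_sq

lemma eisensteinE2_eq_eisSum {w : ℕ} (hw : 3 ≤ w) (hodd : Odd w) (z : ℍ) :
    eisensteinE2 w z = 1 / 2 * eisSum w phiTwo z := by
  have hL := lValue_ne_zero (w := w) (by omega)
  have h1 := tsum_phiTwo_mul_eisSummand hw hodd z
  rw [tsum_mul_eisSummand_eq hw phiTwo_smul] at h1
  change lValue w * _ = _ at h1
  have hc := lipschitzConst_div_lValue (w := w) (by omega) hodd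
  have h4 : (4 : ℂ) ^ w ≠ 0 := pow_ne_zero _ (by norm_num)
  rw [eisensteinE2, eq_div_of_mul_eq hL ((mul_comm _ _).trans h1)]
  generalize (∑' n : ℕ+, twistedSigma (w - 1) chiNegFour (1 : DirichletCharacter ℂ 1) n *
    nome z ^ (n : ℕ)) = S
  have e : 1 / 2 * ((2 * lValue w + 4 * Complex.I * lipschitzConst w / 4 ^ w * S) / lValue w) =
      1 + 2 * Complex.I * S * (lipschitzConst w / (4 ^ w * lValue w)) := by
    field_simp
    ring
  rw [e, hc]
  linear_combination (-2 * S * w / generalizedBernoulli chiNegFour w) * Complex.I_sq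

/-! ### Odd weight -/

/-- The induced character takes the same values as `χ₋₄` on units modulo `4 * p`. -/
lemma chiNegFourLevel_intCast {p : ℕ} {d : ℤ} (hd : IsUnit (d : ZMod (4 * p))) :
    chiNegFourLevel p (d : ZMod (4 * p)) = chiNegFour (d : ZMod 4) := by
  obtain ⟨u, hu⟩ := hd
  rw [← hu, chiNegFourLevel, DirichletCharacter.changeLevel_eq_cast_of_dvd, hu]
  congr 1
  exact ZMod.cast_intCast (Dvd.intro p rfl) d

lemma isUnit_of_mem_Gamma0 {N : ℕ} {γ : SL(2, ℤ)} (hγ : γ ∈ Gamma0 N) :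
    IsUnit ((γ 1 1 : ℤ) : ZMod N) := by
  rw [Gamma0_mem] at hγ
  have hdet : γ 0 0 * γ 1 1 - γ 0 1 * γ 1 0 = 1 := by
    have := γ.det_coe
    rwa [Matrix.det_fin_two] at this
  have h := congrArg (Int.cast : ℤ → ZMod N) hdet
  push_cast at h
  rw [hγ, mul_zero, sub_zero] at h
  exact IsUnit.of_mul_eq_one_right _ h

lemma mem_Gamma0_of_dvd {M N : ℕ} (h : M ∣ N) {γ : SL(2, ℤ)} (hγ : γ ∈ Gamma0 N) :
    γ ∈ Gamma0 M := by
  rw [Gamma0_mem, ZMod.intCast_zmod_eq_zero_iff_dvd] at hγ ⊢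
  exact (Int.natCast_dvd_natCast.2 h).trans hγ

lemma chiNegFourLevel_one_add {p c h : ℕ} (hch : 4 * p ∣ c ^ 2 * h) :
    chiNegFourLevel p ((1 + c * h : ℤ) : ZMod (4 * p)) = chiNegFour ((1 + c * h : ℕ) : ZMod 4) := by
  rw [chiNegFourLevel_intCast]
  · push_cast
    rfl
  · have h0 : ((c : ZMod (4 * p)) ^ 2 * h) = 0 := by
      have := (ZMod.natCast_eq_zero_iff (c ^ 2 * h) (4 * p)).2 hch
      exact_mod_cast this
    refine IsUnit.of_mul_eq_one (1 - c * h : ZMod (4 * p)) ?_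
    push_cast
    linear_combination (-(h : ZMod (4 * p))) * h0

lemma chiNegFour_one_add_of_dvd {n : ℕ} (hn : 4 ∣ n) :
    chiNegFour ((1 + n : ℕ) : ZMod 4) = 1 := by
  rw [chiNegFour_natCast, if_neg (by omega), if_pos (by omega)]

/-- The arithmetic behind the regularity for `χ₋₄` of the cusps `1 / c` with `c` odd or divisible
by `4`: there `χ₋₄(1 + c h) = 1` for the width `h`. -/
lemma four_dvd_mul_cuspWidth {p c : ℕ} (hc : 4 ∣ c ∨ Odd c) : 4 ∣ c * cuspWidth (4 * p) c := by
  rcases hc with hc | hc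
  · exact hc.mul_right _
  · have h := (Dvd.intro p rfl).trans (dvd_sq_mul_cuspWidth (4 * p) c)
    have hcop : Nat.Coprime 4 (c ^ 2) :=
      Nat.Coprime.pow 2 2 (Nat.coprime_two_left.2 hc)
    exact (hcop.dvd_of_dvd_mul_left h).mul_left _

lemma phiOne_vecMul {γ : SL(2, ℤ)} (hγ : γ ∈ Gamma0 4) (a : Fin 2 → ZMod 4) :
    phiOne (a ᵥ* ((γ⁻¹ : SL(2, ℤ)) : SL(2, ZMod 4))) = chiNegFour (γ 1 1 : ZMod 4) * phiOne a := by
  rw [coe_intCast_inv, phiOne, phiOne, ← map_mul]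
  rw [Gamma0_mem] at hγ
  congr 1
  simp [vecMul_eq_sum, Fin.sum_univ_two, hγ, mul_comm]

lemma phiTwo_vecMul {γ : SL(2, ℤ)} (hγ : γ ∈ Gamma0 4) (a : Fin 2 → ZMod 4) :
    phiTwo (a ᵥ* ((γ⁻¹ : SL(2, ℤ)) : SL(2, ZMod 4))) = chiNegFour (γ 1 1 : ZMod 4) * phiTwo a := by
  have hu := isUnit_of_mem_Gamma0 hγ
  rw [Gamma0_mem] at hγ
  have hdet : γ 0 0 * γ 1 1 - γ 0 1 * γ 1 0 = 1 := by
    have := γ.det_coe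
    rwa [Matrix.det_fin_two] at this
  have h := congrArg (Int.cast : ℤ → ZMod 4) hdet
  push_cast at h
  rw [hγ, mul_zero, sub_zero] at h
  -- Every unit modulo `4` is its own inverse.
  have hinv : (γ 0 0 : ZMod 4) = γ 1 1 := by
    revert h
    generalize (γ 0 0 : ZMod 4) = x
    generalize (γ 1 1 : ZMod 4) = y
    revert x y
    decide
  have e0 : (a ᵥ* (((γ⁻¹ : SL(2, ℤ)) : SL(2, ZMod 4)) : Matrix (Fin 2) (Fin 2) (ZMod 4))) 0 =
      a 0 * γ 1 1 := by
    rw [coe_intCast_inv]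
    simp [vecMul_eq_sum, Fin.sum_univ_two, hγ]
  have e1 : (a ᵥ* (((γ⁻¹ : SL(2, ℤ)) : SL(2, ZMod 4)) : Matrix (Fin 2) (Fin 2) (ZMod 4))) 1 =
      -(a 0 * γ 0 1) + a 1 * γ 1 1 := by
    rw [coe_intCast_inv]
    simp [vecMul_eq_sum, Fin.sum_univ_two, hinv]
  rw [phiTwo, phiTwo, e0, e1]
  by_cases h0 : a 0 = 0
  · rw [if_pos h0, if_pos (by rw [h0, zero_mul]), h0, zero_mul, neg_zero, zero_add, map_mul,
      mul_comm]
  · rw [if_neg h0, if_neg (mt hu.mul_left_eq_zero.1 h0), mul_zero]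

lemma eisSum_slash_of_vecMul {w : ℤ} {φ : (Fin 2 → ZMod 4) → ℂ} {γ : SL(2, ℤ)} {c : ℂ}
    (h : ∀ a, φ (a ᵥ* ((γ⁻¹ : SL(2, ℤ)) : SL(2, ZMod 4))) = c * φ a) :
    eisSum w φ ∣[w] γ = c • eisSum w φ := by
  rw [eisSum_slash]
  ext z
  simp only [eisSum, h, Pi.smul_apply, smul_eq_mul, Finset.mul_sum, mul_assoc]

/-- The modular form `E⁽¹⁾_w`, as a normalized sum over the lattice. -/
def formOne (w : ℕ) : ℍ → ℂ := (Complex.I / 4 ^ w) • eisSum w phiOne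

/-- The modular form `E⁽²⁾_w`, as a normalized sum over the lattice. -/
def formTwo (w : ℕ) : ℍ → ℂ := (1 / 2 : ℂ) • eisSum w phiTwo

lemma formOne_slash (w : ℕ) {γ : SL(2, ℤ)} (hγ : γ ∈ Gamma0 4) :
    formOne w ∣[(w : ℤ)] γ = chiNegFour (γ 1 1 : ZMod 4) • formOne w := by
  rw [formOne, ModularForm.SL_smul_slash, eisSum_slash_of_vecMul (phiOne_vecMul hγ), smul_comm]

lemma formTwo_slash (w : ℕ) {γ : SL(2, ℤ)} (hγ : γ ∈ Gamma0 4) :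
    formTwo w ∣[(w : ℤ)] γ = chiNegFour (γ 1 1 : ZMod 4) • formTwo w := by
  rw [formTwo, ModularForm.SL_smul_slash, eisSum_slash_of_vecMul (phiTwo_vecMul hγ), smul_comm]

lemma scale_slash_of_Gamma0_four {w p : ℕ} [NeZero p] {F : ℍ → ℂ}
    (hF : ∀ γ ∈ Gamma0 4, F ∣[(w : ℤ)] γ = chiNegFour (γ 1 1 : ZMod 4) • F) {γ : SL(2, ℤ)}
    (hγ : γ ∈ Gamma0 (4 * p)) :
    scale p F ∣[(w : ℤ)] γ = chiNegFour (γ 1 1 : ZMod 4) • scale p F := by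
  obtain ⟨γ', hγ', h11, h⟩ := exists_scale_slash_eq hγ
  rw [h, hF γ' hγ', h11]
  rfl

/-- The value of `E⁽¹⁾_w` at the cusp `a / c` is `-2i χ₋₄(c) / 4 ^ w`. -/
lemma tendsto_formOne_slash {w : ℕ} (hw : 3 ≤ w) (hodd : Odd w) (γ : SL(2, ℤ)) :
    Tendsto (formOne w ∣[(w : ℤ)] γ) atImInfty
      (𝓝 (-2 * Complex.I / 4 ^ w * chiNegFour (γ 1 0 : ZMod 4))) := by
  have h := (tendsto_eisSum_slash hw hodd phiOne γ).const_smul (Complex.I / 4 ^ w)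
  have hval : (Complex.I / 4 ^ w) •
      (phiOne ![-(γ 1 0 : ZMod 4), γ 0 0] - phiOne ![(γ 1 0 : ZMod 4), -γ 0 0]) =
      -2 * Complex.I / 4 ^ w * chiNegFour (γ 1 0 : ZMod 4) := by
    simp only [phiOne, cons_val_zero, chiNegFour_neg, smul_eq_mul]
    ring
  rw [hval] at h
  rw [formOne, ModularForm.SL_smul_slash]
  exact h

/-- The value of `E⁽²⁾_w` at the cusp `a / c` is `χ₋₄(a)` if `4 ∣ c`, and `0` otherwise. -/
lemma tendsto_formTwo_slash {w : ℕ} (hw : 3 ≤ w) (hodd : Odd w) (γ : SL(2, ℤ)) :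
    Tendsto (formTwo w ∣[(w : ℤ)] γ) atImInfty
      (𝓝 (if (γ 1 0 : ZMod 4) = 0 then chiNegFour (γ 0 0 : ZMod 4) else 0)) := by
  have h := (tendsto_eisSum_slash hw hodd phiTwo γ).const_smul (1 / 2 : ℂ)
  have hval : (1 / 2 : ℂ) •
      (phiTwo ![-(γ 1 0 : ZMod 4), γ 0 0] - phiTwo ![(γ 1 0 : ZMod 4), -γ 0 0]) =
      if (γ 1 0 : ZMod 4) = 0 then chiNegFour (γ 0 0 : ZMod 4) else 0 := by
    simp only [phiTwo, cons_val_zero, cons_val_one, chiNegFour_neg, smul_eq_mul, neg_eq_zero]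
    split_ifs <;> ring
  rw [hval] at h
  rw [formTwo, ModularForm.SL_smul_slash]
  exact h

lemma tendsto_scale_formOne {w d c : ℕ} [NeZero d] (hw : 3 ≤ w) (hodd : Odd w) (u d' c' : ℕ)
    (hd : d = u * d') (hc : c = u * c') (hcop : Nat.Coprime d' c') :
    Tendsto (scale d (formOne w) ∣[(w : ℤ)] cuspRep c) atImInfty
      (𝓝 (((d' : ℂ) ^ w)⁻¹ * (-2 * Complex.I / 4 ^ w * chiNegFour (c' : ZMod 4)))) := by
  subst hd hc
  have := tendsto_scale_slash_cuspRep (u := u) (d := d') (c := c') (w := w)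
    (F := formOne w) (L := -2 * Complex.I / 4 ^ w * chiNegFour (c' : ZMod 4)) hcop
    fun γ _ h10 => by simpa [h10] using tendsto_formOne_slash hw hodd γ
  simpa using this

lemma tendsto_scale_formTwo {w d c : ℕ} [NeZero d] (hw : 3 ≤ w) (hodd : Odd w) (u d' c' : ℕ)
    (hd : d = u * d') (hc : c = u * c') (hcop : Nat.Coprime d' c') :
    Tendsto (scale d (formTwo w) ∣[(w : ℤ)] cuspRep c) atImInfty
      (𝓝 (((d' : ℂ) ^ w)⁻¹ * if 4 ∣ c' then chiNegFour (d' : ZMod 4) else 0)) := by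
  subst hd hc
  have := tendsto_scale_slash_cuspRep (u := u) (d := d') (c := c') (w := w)
    (F := formTwo w) (L := if 4 ∣ c' then chiNegFour (d' : ZMod 4) else 0) hcop
    fun γ h00 h10 => by
      simpa [h00, h10, ZMod.natCast_eq_zero_iff] using tendsto_formTwo_slash hw hodd γ
  simpa using this

lemma odd_weight_decomposition {k p : ℕ} (hk : 1 < k) (hp : p.Prime) (hp2 : p ≠ 2)
    {f : ModularForm (Gamma1 (4 * p) : Subgroup (GL (Fin 2) ℝ)) ((2 * k - 1 : ℕ) : ℤ)}
    (hf : f ∈ modularFormsWithCharacter (4 * p) ((2 * k - 1 : ℕ) : ℤ) (chiNegFourLevel p)) :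
    ∃ C ∈ cuspFormsWithCharacter (4 * p) ((2 * k - 1 : ℕ) : ℤ) (chiNegFourLevel p),
      ∀ τ : ℍ,
        f τ =
          ((2 ^ (2 * k - 1) - 1) * coeffB (2 * k - 1) p 4 f) * eisensteinE2 (2 * k - 1) τ
          + (-(2 ^ (2 * k - 1) - 1) * pChi p ^ (2 * k - 1) * coeffA (2 * k - 1) p 4 f) *
              eisensteinE2 (2 * k - 1) (p * τ)
          + (Complex.I * 4 ^ (2 * k - 1) * (2 ^ (2 * k - 1) - 1) / 2 *
              coeffB (2 * k - 1) p 1 f) * eisensteinE1 (2 * k - 1) τ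
          + (-Complex.I * (4 * p : ℂ) ^ (2 * k - 1) * (2 ^ (2 * k - 1) - 1) / 2 *
              coeffA (2 * k - 1) p 1 f) * eisensteinE1 (2 * k - 1) (p * τ)
          + C τ := by
  have hw : 3 ≤ 2 * k - 1 := by omega
  have hodd : Odd (2 * k - 1) := ⟨k - 1, by omega⟩
  generalize 2 * k - 1 = w at *
  have hpodd : p % 2 = 1 := hp.eq_two_or_odd.resolve_left hp2
  have : NeZero p := ⟨hp.ne_zero⟩
  have : NeZero (4 * p) := ⟨by have := hp.pos; omega⟩
  have hw' : (3 : ℤ) ≤ w := by exact_mod_cast hw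
  set a1 := (2 ^ w - 1) * coeffB w p 4 f with ha1
  set a2 := -(2 ^ w - 1) * pChi p ^ w * coeffA w p 4 f with ha2
  set a3 := Complex.I * 4 ^ w * (2 ^ w - 1) / 2 * coeffB w p 1 f with ha3
  set a4 := -Complex.I * (4 * p : ℂ) ^ w * (2 ^ w - 1) / 2 * coeffA w p 1 f with ha4
  have hol1 : MDiff (formOne w) := (MDiff_eisSum hw' phiOne).const_smul _
  have hol2 : MDiff (formTwo w) := (MDiff_eisSum hw' phiTwo).const_smul _
  set G : ℍ → ℂ := a1 • scale 1 (formTwo w) + a2 • scale p (formTwo w) +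
    a3 • scale 1 (formOne w) + a4 • scale p (formOne w) with hG
  have hGol : MDiff G :=
    ((((MDiff_scale 1 hol2).const_smul a1).add ((MDiff_scale p hol2).const_smul a2)).add
      ((MDiff_scale 1 hol1).const_smul a3)).add ((MDiff_scale p hol1).const_smul a4)
  have hGslash (γ : SL(2, ℤ)) : G ∣[(w : ℤ)] γ = a1 • (scale 1 (formTwo w) ∣[(w : ℤ)] γ) +
      a2 • (scale p (formTwo w) ∣[(w : ℤ)] γ) + a3 • (scale 1 (formOne w) ∣[(w : ℤ)] γ) +
      a4 • (scale p (formOne w) ∣[(w : ℤ)] γ) := by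
    simp only [hG, SlashAction.add_slash, ModularForm.SL_smul_slash]
  have hGinv : ∀ γ ∈ Gamma0 (4 * p),
      G ∣[(w : ℤ)] γ = chiNegFourLevel p (γ 1 1 : ZMod (4 * p)) • G := fun γ hγ => by
    have hγ4 : γ ∈ Gamma0 (4 * 1) := mem_Gamma0_of_dvd (Dvd.intro p (by ring)) hγ
    rw [hGslash, chiNegFourLevel_intCast (isUnit_of_mem_Gamma0 hγ),
      scale_slash_of_Gamma0_four (fun γ => formTwo_slash w) hγ4,
      scale_slash_of_Gamma0_four (fun γ => formTwo_slash w) hγ,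
      scale_slash_of_Gamma0_four (fun γ => formOne_slash w) hγ4,
      scale_slash_of_Gamma0_four (fun γ => formOne_slash w) hγ, hG]
    simp only [smul_add, smul_comm (chiNegFour (γ 1 1 : ZMod 4))]
  have hinv : ∀ γ ∈ Gamma0 (4 * p), (⇑f - G) ∣[(w : ℤ)] γ =
      chiNegFourLevel p (γ 1 1 : ZMod (4 * p)) • (⇑f - G) := fun γ hγ => by
    rw [sub_eq_add_neg, SlashAction.add_slash, SlashAction.neg_slash, hf γ hγ, hGinv γ hγ,
      ← smul_neg, ← smul_add]
  have hol : MDiff (⇑f - G) := (ModularFormClass.holo f).sub hGol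
  have hb (c : ℕ) : IsBoundedAtImInfty (⇑f ∣[(w : ℤ)] cuspRep c) :=
    ModularFormClass.bdd_at_infty_slash f _
  have hregular {c : ℕ} (hc : 4 ∣ c ∨ Odd c) : Tendsto (⇑f ∣[(w : ℤ)] cuspRep c) atImInfty
      (𝓝 (constTerm p w c f)) := by
    refine tendsto_constTerm (ψ := fun d => chiNegFourLevel p (d : ZMod (4 * p))) hp.pos hf
      (ModularFormClass.holo f) (hb c) ?_
    rw [chiNegFourLevel_one_add (dvd_sq_mul_cuspWidth _ _)]
    exact chiNegFour_one_add_of_dvd (four_dvd_mul_cuspWidth hc)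
  -- The cusps `1 / 2` and `1 / (2 p)` are irregular.
  have hirregular {c h : ℕ} (hh : 0 < h) (hdvd : 4 * p ∣ c ^ 2 * h) (hch : c * h = 2 * p) :
      Tendsto (⇑f ∣[(w : ℤ)] cuspRep c) atImInfty (𝓝 0) := by
    refine tendsto_zero_of_antiperiodic (Nat.cast_pos.2 hh) (fun τ => ?_)
      (MDiff_slash_SL (ModularFormClass.holo f) _ _) (hb c)
    rw [cuspRep_slash_vadd (ψ := fun d => chiNegFourLevel p (d : ZMod (4 * p))) hf hdvd,
      chiNegFourLevel_one_add hdvd, hch, chiNegFour_natCast, if_neg (by omega), if_neg (by omega),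
      neg_one_mul]
  -- The value at a cusp of the difference, from the values of the four Eisenstein series there.
  have key {c : ℕ} {v e1 e2 e3 e4 : ℂ}
      (hv : Tendsto (⇑f ∣[(w : ℤ)] cuspRep c) atImInfty (𝓝 v))
      (h1 : Tendsto (scale 1 (formTwo w) ∣[(w : ℤ)] cuspRep c) atImInfty (𝓝 e1))
      (h2 : Tendsto (scale p (formTwo w) ∣[(w : ℤ)] cuspRep c) atImInfty (𝓝 e2))
      (h3 : Tendsto (scale 1 (formOne w) ∣[(w : ℤ)] cuspRep c) atImInfty (𝓝 e3))
      (h4 : Tendsto (scale p (formOne w) ∣[(w : ℤ)] cuspRep c) atImInfty (𝓝 e4))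
      (hve : v = a1 * e1 + a2 * e2 + a3 * e3 + a4 * e4) :
      Tendsto ((⇑f - G) ∣[(w : ℤ)] cuspRep c) atImInfty (𝓝 0) := by
    have hlim := hv.sub ((((h1.const_smul a1).add (h2.const_smul a2)).add
      (h3.const_smul a3)).add (h4.const_smul a4))
    simp only [smul_eq_mul] at hlim
    rw [← hve, sub_self] at hlim
    rw [sub_eq_add_neg, SlashAction.add_slash, SlashAction.neg_slash, ← sub_eq_add_neg, hGslash]
    exact hlim
  have hp0 : (p : ℂ) ≠ 0 := Nat.cast_ne_zero.2 hp.ne_zero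
  have hpw : (p : ℂ) ^ w ≠ 0 := pow_ne_zero _ hp0
  have h4w : (4 : ℂ) ^ w ≠ 0 := pow_ne_zero _ (by norm_num)
  have hA := two_pow_sub_one_ne_zero (w := w) (by omega)
  have hP := pChi_pow_sub_one_ne_zero (w := w) hp hp2 (by omega)
  have hPχ : pChi p ^ w = chiP p * (p : ℂ) ^ w := by
    rcases chiP_eq_one_or hpodd with h | h <;> simp [pChi, h, hodd.neg_pow]
  have hχw : chiP p ^ w = chiP p := by
    rcases chiP_eq_one_or hpodd with h | h <;> simp [h, hodd.neg_one_pow]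
  have hχ4 : chiP p ^ (4 * w) = 1 := by
    rw [mul_comm, pow_mul, hχw]
    rcases chiP_eq_one_or hpodd with h | h <;> norm_num [h]
  have hχχ : chiP p * chiP p = 1 := by
    rcases chiP_eq_one_or hpodd with h | h <;> norm_num [h]
  rw [hPχ] at hP
  -- The coefficients in terms of the constant terms. The common value `-2i / 4 ^ w` of `E⁽¹⁾_w` at
  -- the cusp `1` is absorbed into `a3` and `a4`.
  have v1 : a1 = (chiP p * (p : ℂ) ^ w * constTerm p w 4 f - constTerm p w (4 * p) f) /
      (chiP p * (p : ℂ) ^ w - 1) := by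
    rw [ha1, coeffB, hPχ, hχ4, one_mul]
    field_simp
  have v2 : a2 = -(chiP p * (p : ℂ) ^ w * (constTerm p w 4 f - constTerm p w (4 * p) f)) /
      (chiP p * (p : ℂ) ^ w - 1) := by
    rw [ha2, coeffA, hPχ, hχ4, one_mul]
    field_simp
  have v3 : a3 * (-2 * Complex.I / 4 ^ w) =
      chiP p * ((p : ℂ) ^ w * constTerm p w 1 f - constTerm p w p f) /
        (chiP p * (p : ℂ) ^ w - 1) := by
    have : a3 * (-2 * Complex.I / 4 ^ w) = -(Complex.I * Complex.I) *
        (chiP p * ((p : ℂ) ^ w * constTerm p w 1 f - constTerm p w p f) /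
          (chiP p * (p : ℂ) ^ w - 1)) := by
      rw [ha3, coeffB, hPχ, one_mul, one_mul, hχw]
      field_simp
    rw [this, Complex.I_mul_I, neg_neg, one_mul]
  have v4 : a4 * (-2 * Complex.I / 4 ^ w) =
      -((p : ℂ) ^ w * (constTerm p w 1 f - chiP p * constTerm p w p f)) /
        (chiP p * (p : ℂ) ^ w - 1) := by
    have : a4 * (-2 * Complex.I / 4 ^ w) = Complex.I * Complex.I *
        ((p : ℂ) ^ w * (constTerm p w 1 f - chiP p * constTerm p w p f) /
          (chiP p * (p : ℂ) ^ w - 1)) := by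
      rw [ha4, coeffA, hPχ, one_mul, one_mul, hχw, mul_pow]
      field_simp
    rw [this, Complex.I_mul_I]
    ring
  have hzero : ∀ t ∈ ({1, 2, 4} : Finset ℕ), ∀ s ∈ ({1, p} : Finset ℕ),
      Tendsto ((⇑f - G) ∣[(w : ℤ)] cuspRep (t * s)) atImInfty (𝓝 0) := by
    simp only [Finset.mem_insert, Finset.mem_singleton, forall_eq_or_imp, forall_eq]
    have T1 := fun (d c : ℕ) [NeZero d] => tendsto_scale_formOne (d := d) (c := c) hw hodd
    have T2 := fun (d c : ℕ) [NeZero d] => tendsto_scale_formTwo (d := d) (c := c) hw hodd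
    have cp2 : Nat.Coprime p 2 := (Nat.coprime_primes hp Nat.prime_two).2 hp2
    have cp4 : Nat.Coprime p 4 := cp2.pow_right 2
    have l1 (c : ℕ) : Nat.Coprime 1 c := Nat.coprime_one_left c
    have r1 (c : ℕ) : Nat.Coprime c 1 := Nat.coprime_one_right c
    have n1 : ¬ 4 ∣ 1 := by norm_num
    have n2 : ¬ 4 ∣ 2 := by norm_num
    have np : ¬ 4 ∣ p := by omega
    have n2p : ¬ 4 ∣ 2 * p := by omega
    have d4p : 4 ∣ 4 * p := Dvd.intro p rfl
    have χp : chiNegFour (p : ZMod 4) = chiP p := rfl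
    have χ1 : chiNegFour ((1 : ℕ) : ZMod 4) = 1 := by rw [chiNegFour_natCast]; rfl
    have χ2 : chiNegFour ((2 : ℕ) : ZMod 4) = 0 := by rw [chiNegFour_natCast]; rfl
    have χ4 : chiNegFour ((4 : ℕ) : ZMod 4) = 0 := by rw [chiNegFour_natCast]; rfl
    have χ2p : chiNegFour ((2 * p : ℕ) : ZMod 4) = 0 := by
      rw [chiNegFour_natCast, if_pos (by omega)]
    have χ4p : chiNegFour ((4 * p : ℕ) : ZMod 4) = 0 := by
      rw [chiNegFour_natCast, if_pos (by omega)]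
    refine ⟨⟨key (hregular (Or.inr (by decide)))
        (T2 _ _ 1 1 1 (by ring) (by ring) (l1 _)) (T2 _ _ 1 p 1 (by ring) (by ring) (r1 _))
        (T1 _ _ 1 1 1 (by ring) (by ring) (l1 _)) (T1 _ _ 1 p 1 (by ring) (by ring) (r1 _)) ?_,
      key (hregular (Or.inr (by rw [one_mul]; exact Nat.odd_iff.2 hpodd)))
        (T2 _ _ 1 1 p (by ring) (by ring) (l1 _)) (T2 _ _ p 1 1 (by ring) (by ring) (l1 _))
        (T1 _ _ 1 1 p (by ring) (by ring) (l1 _)) (T1 _ _ p 1 1 (by ring) (by ring) (l1 _)) ?_⟩,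
      ⟨key (hirregular hp.pos (Dvd.intro 1 (by ring)) (by ring))
        (T2 _ _ 1 1 2 (by ring) (by ring) (l1 _)) (T2 _ _ 1 p 2 (by ring) (by ring) cp2)
        (T1 _ _ 1 1 2 (by ring) (by ring) (l1 _)) (T1 _ _ 1 p 2 (by ring) (by ring) cp2) ?_,
      key (hirregular one_pos (Dvd.intro p (by ring)) (by ring))
        (T2 _ _ 1 1 (2 * p) (by ring) (by ring) (l1 _)) (T2 _ _ p 1 2 (by ring) (by ring) (l1 _))
        (T1 _ _ 1 1 (2 * p) (by ring) (by ring) (l1 _)) (T1 _ _ p 1 2 (by ring) (by ring) (l1 _))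
        ?_⟩,
      key (hregular (Or.inl (by norm_num)))
        (T2 _ _ 1 1 4 (by ring) (by ring) (l1 _)) (T2 _ _ 1 p 4 (by ring) (by ring) cp4)
        (T1 _ _ 1 1 4 (by ring) (by ring) (l1 _)) (T1 _ _ 1 p 4 (by ring) (by ring) cp4) ?_,
      key (hregular (Or.inl d4p))
        (T2 _ _ 1 1 (4 * p) (by ring) (by ring) (l1 _)) (T2 _ _ p 1 4 (by ring) (by ring) (l1 _))
        (T1 _ _ 1 1 (4 * p) (by ring) (by ring) (l1 _)) (T1 _ _ p 1 4 (by ring) (by ring) (l1 _))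
        ?_⟩
    · rw [if_neg n1, if_neg n1, χ1, Nat.cast_one]
      have e : constTerm p w (1 * 1) f = a3 * (-2 * Complex.I / 4 ^ w) +
          ((p : ℂ) ^ w)⁻¹ * (a4 * (-2 * Complex.I / 4 ^ w)) := by
        rw [v3, v4, one_mul]
        field_simp
        ring
      rw [e]
      ring
    · rw [if_neg np, if_neg n1, χ1, χp, Nat.cast_one]
      have e : constTerm p w (1 * p) f = chiP p * (a3 * (-2 * Complex.I / 4 ^ w)) +
          a4 * (-2 * Complex.I / 4 ^ w) := by
        rw [v3, v4, one_mul]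
        field_simp
        linear_combination (-((p : ℂ) ^ w * constTerm p w 1 f - constTerm p w p f)) * hχχ
      rw [e]
      ring
    · rw [if_neg n2, if_neg n2, show ((2 * 1 : ℕ) : ZMod 4) = (2 : ℕ) from rfl, χ2]
      ring
    · simp only [if_neg n2, if_neg n2p, χ2, χ2p]
      ring
    · rw [if_pos dvd_rfl, if_pos dvd_rfl, χ1, χ4, χp, Nat.cast_one]
      have e : constTerm p w (4 * 1) f = a1 + a2 * (((p : ℂ) ^ w)⁻¹ * chiP p) := by
        rw [v1, v2, mul_one]
        field_simp
        linear_combination (constTerm p w 4 f - constTerm p w (4 * p) f) * hχχ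
      rw [e]
      ring
    · rw [if_pos dvd_rfl, if_pos d4p, χ1, χ4, χ4p, Nat.cast_one, v1, v2]
      field_simp
      ring
  have hinv1 : ∀ γ ∈ Gamma1 (4 * p), (⇑f - G) ∣[(w : ℤ)] γ = ⇑f - G := fun γ hγ => by
    rw [hinv γ (Gamma1_in_Gamma0 _ hγ), ((Gamma1_mem _ _).1 hγ).2.1, map_one, one_smul]
  refine ⟨mkCuspForm (Gamma1 (4 * p)) _ (⇑f - G) hinv1 hol
    (isZeroAtImInfty_slash hp hp2 (ψ := fun γ => chiNegFourLevel p (γ 1 1 : ZMod (4 * p))) hinv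
      hzero), hinv, fun τ => ?_⟩
  have hs1 (d : ℕ) [NeZero d] : scale d (formOne w) τ = eisensteinE1 w (d * τ) :=
    (eisensteinE1_eq_eisSum hw hodd (scalePoint d τ)).symm
  have hs2 (d : ℕ) [NeZero d] : scale d (formTwo w) τ = eisensteinE2 w (d * τ) :=
    (eisensteinE2_eq_eisSum hw hodd (scalePoint d τ)).symm
  simp only [coe_mkCuspForm, hG, Pi.sub_apply, Pi.add_apply, Pi.smul_apply, smul_eq_mul, hs1, hs2]
  push_cast
  ring_nf

end EisensteinPart

end

open EisensteinPart in
theorem mainTheorem2 (k p : ℕ) (hk : 1 < k) (hp : p.Prime) (hp2 : p ≠ 2) :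
    (∀ f : ModularForm (Gamma0 (4 * p) : Subgroup (GL (Fin 2) ℝ)) ((2 * k : ℕ) : ℤ),
      ∃ C : CuspForm (Gamma0 (4 * p) : Subgroup (GL (Fin 2) ℝ)) ((2 * k : ℕ) : ℤ),
        ∀ τ : ℍ,
          f τ =
            (2 ^ (2 * k) * coeffB (2 * k) p 1 f - coeffB (2 * k) p 2 f) *
                eisensteinE (2 * k) τ
            + (-2 ^ (2 * k) * coeffB (2 * k) p 1 f + (2 ^ (2 * k) + 1) * coeffB (2 * k) p 2 f
                - coeffB (2 * k) p 4 f) * eisensteinE (2 * k) (2 * τ)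
            + (-2 ^ (2 * k) * (coeffB (2 * k) p 2 f - coeffB (2 * k) p 4 f)) *
                eisensteinE (2 * k) (4 * τ)
            + (-(p : ℂ) ^ (2 * k) * (2 ^ (2 * k) * coeffA (2 * k) p 1 f
                - coeffA (2 * k) p 2 f)) * eisensteinE (2 * k) (p * τ)
            + ((p : ℂ) ^ (2 * k) * (2 ^ (2 * k) * coeffA (2 * k) p 1 f
                - (2 ^ (2 * k) + 1) * coeffA (2 * k) p 2 f + coeffA (2 * k) p 4 f)) *
                eisensteinE (2 * k) (2 * p * τ)
            + ((2 * p : ℂ) ^ (2 * k) * (coeffA (2 * k) p 2 f - coeffA (2 * k) p 4 f)) *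
                eisensteinE (2 * k) (4 * p * τ)
            + C τ) ∧
    (∀ f ∈ modularFormsWithCharacter (4 * p) ((2 * k - 1 : ℕ) : ℤ) (chiNegFourLevel p),
      ∃ C ∈ cuspFormsWithCharacter (4 * p) ((2 * k - 1 : ℕ) : ℤ) (chiNegFourLevel p),
        ∀ τ : ℍ,
          f τ =
            ((2 ^ (2 * k - 1) - 1) * coeffB (2 * k - 1) p 4 f) * eisensteinE2 (2 * k - 1) τ
            + (-(2 ^ (2 * k - 1) - 1) * pChi p ^ (2 * k - 1) * coeffA (2 * k - 1) p 4 f) *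
                eisensteinE2 (2 * k - 1) (p * τ)
            + (Complex.I * 4 ^ (2 * k - 1) * (2 ^ (2 * k - 1) - 1) / 2 *
                coeffB (2 * k - 1) p 1 f) * eisensteinE1 (2 * k - 1) τ
            + (-Complex.I * (4 * p : ℂ) ^ (2 * k - 1) * (2 ^ (2 * k - 1) - 1) / 2 *
                coeffA (2 * k - 1) p 1 f) * eisensteinE1 (2 * k - 1) (p * τ)
            + C τ) := by
  exact ⟨fun f => even_weight_decomposition hk hp hp2 f,
    fun _ hf => odd_weight_decomposition hk hp hp2 hf⟩
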